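/- Fix an integer $M\ge 1$ and put $\Omega_M=\{0,1,\dots,M\}^{\mathbb N}$, with lexicographical order $\prec$ and left shift $\sigma$. Reflection means $\overline{(x_i)}=(M-x_i)$, for sequences and words. For $q\in(1,M+1]$ let $\alpha(q)\in\Omega_M$ be the lexicographically largest sequence $(x_i)$ not ending with $0^\infty$ such that $\sum_{i\ge1}x_iq^{-i}=1$, and let \[\widetilde{\mathbf U}_q=\{x\in\Omega_M:\overline{\alpha(q)}\prec\sigma^n(x)\prec\alpha(q)\ \ \forall n\ge 0\}.\] Let $\mathscr U$ be the set of $q\in(1,M+1]$ for which there is exactly one $(x_i)\in\Omega_M$ with $\sum_{i\ge1} x_iq^{-i}=1$, and let $\mathscr V$ be the set of $q\in(1,M+1]$ with $\widetilde{\mathbf U}_r\ne\widetilde{\mathbf U}_q$ for all $r\in(q,M+1]$. A superscript $*$ denotes the same objects for $M=1$. For $X\subset\Omega_M$ let $h(X)=\liminf_{n\to\infty}\frac1n\log\#B_n(X)$, where $B_n(X)$ is the set of words of length $n$ occurring in sequences of $X$ (with $h(\emptyset)=0$). A word $\mathbf a=a_1\dots a_m$ over $\{0,\dots,M\}$ is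 admissible if either $m\ge 2$ and $\overline{a_1\dots a_{m-i}}\preccurlyeq a_{i+1}\dots a_m\prec a_1\dots a_{m-i}$ for all $1\le i<m$, or $m=1$, $M\ge2$ and $\overline{a_1}\le a_1<M$. Let $\mathbf a^+=a_1\dots a_{m-1}(a_m+1)$. Let $\mathbf a$ be an admissible word and let $J=[q_L,q_R]$ be the interval generated by it, that is, $q_L,q_R\in(1,M+1]$, $\alpha(q_L)=\mathbf a^\infty$ and $\alpha(q_R)=\mathbf a^+(\overline{\mathbf a})^\infty$. (Every relative entropy plateau other than $[1,M+1]$ is such an interval.) For $q\in(q_L,q_R]$ let $\widetilde{\mathbf U}_q(J)$ be the set of sequences in $\widetilde{\mathbf U}_q$ that begin with $\mathbf a^+$. Consider the directed graph with vertices $\mathrm{Start},A,B$ and five edges, each with a label and a reference label: $\mathrm{Start}\to A$ with $\mathbf a^+/1$; $A\to A$ with $\overline{\mathbf a}/1$; $A\to B$ with $\overline{\mathbf a^+}/0$; $B\to B$ with $\mathbf a/0$; $B\to A$ with $\mathbf a^+/1$. Let $X(J)\subset\Omega_M$ be the set of sequences obtained by concatenating the labels along an infinite path from $\mathrm{Start}$;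 this path is determined by the sequence, and $\Phi_J:X(J)\to\{0,1\}^{\mathbb N}$ sends the sequence to the sequence of reference labels along the path. Put $\hat\Phi_J(q)=(\alpha^*)^{-1}(\Phi_J(\alpha(q)))$ for $q\in\mathscr V\cap(q_L,q_R]$. Then $\hat\Phi_J$ is well defined, that is, $\alpha(q)\in X(J)$ and $\Phi_J(\alpha(q))$ is of the form $\alpha^*(p)$ with $p\in(1,2]$ for every $q\in\mathscr V\cap(q_L,q_R]$, and the following hold. (i) $\hat\Phi_J$ is a strictly increasing homeomorphism from $\mathscr V\cap(q_L,q_R]$ onto $\mathscr V^*$. (ii) $\mathscr U\cap J\subset\mathscr V\cap(q_L,q_R]$ and $\hat\Phi_J(\mathscr U\cap(q_L,q_R])=\hat\Phi_J(\mathscr U\cap J)=\mathscr U^*$. (iii) For every $q\in\mathscr V\cap(q_L,q_R]$, with $\hat q=\hat\Phi_J(q)$, we have $\widetilde{\mathbf U}_q(J)\subset X(J)$, the map $\Phi_J$ maps $\widetilde{\mathbf U}_q(J)$ bijectively onto $\{(x_i)\in\widetilde{\mathbf U}^*_{\hat q}:x_1=1\}$, and \[h(\widetilde{\mathbf U}_q(J))=\frac{h(\widetilde{\mathbf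 U}^*_{\hat q})}{m}.\] -/

import Mathlib

open Set Filter

namespace UnivoqueBases

/-- Sequences over the alphabet `{0, 1, …, M}`; the paper's index `i ≥ 1` is `i - 1` here.
The lexicographical order is the order of `Lex (ℕ → Fin (M + 1))`, reached through `toLex`. -/
abbrev Seq (M : ℕ) := ℕ → Fin (M + 1)

/-- Finite words over the alphabet `{0, 1, …, M}`. Only words of equal length are ever compared,
so the order of `List` is the lexicographical one. -/
abbrev Word (M : ℕ) := List (Fin (M + 1))

/-- The left shift iterated `n` times. -/
def shift {M : ℕ} (n : ℕ) (x : Seq M) : Seq M := fun i => x (n + i)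

/-- The reflection `(M - x_i)` of a sequence. -/
def reflect {M : ℕ} (x : Seq M) : Seq M := fun i => (x i).rev

/-- The reflection of a word. -/
def reflectWord {M : ℕ} (w : Word M) : Word M := w.map Fin.rev

/-- `w⁺`: the last digit is increased by one (used only if that digit is less than `M`). -/
def plusWord {M : ℕ} (w : Word M) : Word M := w.modify (w.length - 1) (fun d => d + 1)

/-- The infinite concatenation `w 0 w 1 w 2 …` of blocks which all have length `m ≥ 1`. -/
def concat {M : ℕ} (m : ℕ) (w : ℕ → Word M) : Seq M := fun n => (w (n / m)).getD (n % m) 0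

/-- The value `∑ x_i / q ^ i` (`i ≥ 1`) of a sequence in base `q`. -/
noncomputable def value {M : ℕ} (q : ℝ) (x : Seq M) : ℝ :=
  ∑' i : ℕ, ((x i : ℕ) : ℝ) / q ^ (i + 1)

/-- The bases `q ∈ (1, M + 1]` in which `1` has a unique expansion. -/
def univoqueBases (M : ℕ) : Set ℝ :=
  {q | q ∈ Ioc (1 : ℝ) (M + 1) ∧ ∃! x : Seq M, value q x = 1}

/-- `x` is the lexicographically largest expansion of `1` in base `q` not ending with `0^∞`. -/
def IsQuasiGreedy {M : ℕ} (q : ℝ) (x : Seq M) : Prop :=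
  IsGreatest {y : Lex (Seq M) | value q (ofLex y) = 1 ∧ ¬ ∃ N, ∀ n ≥ N, ofLex y n = 0} (toLex x)

/-- The quasi-greedy expansion `α(q)` of `1`, for `q ∈ (1, M + 1]`. -/
noncomputable def alpha (M : ℕ) (q : ℝ) : Seq M :=
  Classical.epsilon fun x : Seq M => IsQuasiGreedy q x

/-- The set `Ũ_q`. -/
def tildeU (M : ℕ) (q : ℝ) : Set (Seq M) :=
  {x | ∀ n : ℕ, toLex (reflect (alpha M q)) < toLex (shift n x) ∧
    toLex (shift n x) < toLex (alpha M q)}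

/-- The right bifurcation set of `q ↦ Ũ_q`. -/
def bifV (M : ℕ) : Set ℝ :=
  {q | q ∈ Ioc (1 : ℝ) (M + 1) ∧ ∀ r ∈ Ioc q ((M : ℝ) + 1), tildeU M r ≠ tildeU M q}

/-- The words of length `n` that occur (at any position) in some sequence of `X`. -/
def blocks {M : ℕ} (n : ℕ) (X : Set (Seq M)) : Set (Fin n → Fin (M + 1)) :=
  {w | ∃ x ∈ X, ∃ k : ℕ, ∀ i : Fin n, w i = x (k + i)}

/-- Topological entropy. Since `Real.log 0 = 0`, the empty set has entropy `0`. -/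
noncomputable def entropy {M : ℕ} (X : Set (Seq M)) : ℝ :=
  liminf (fun n : ℕ => Real.log ((blocks n X).ncard : ℝ) / n) atTop

/-- Admissible words. -/
def Admissible {M : ℕ} (a : Word M) : Prop :=
  (2 ≤ a.length ∧ ∀ i, 1 ≤ i → i < a.length →
    reflectWord (a.take (a.length - i)) ≤ a.drop i ∧ a.drop i < a.take (a.length - i)) ∨
  (2 ≤ M ∧ ∃ d : Fin (M + 1), a = [d] ∧ d.rev ≤ d ∧ d < Fin.last M)

/-- `[qL, qR]` is the basic interval generated by the admissible word `a`:
`α(qL) = a^∞` and `α(qR) = a⁺ (reflection of a)^∞`. -/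
structure IsBasicInterval {M : ℕ} (a : Word M) (qL qR : ℝ) : Prop where
  admissible : Admissible a
  left_mem : qL ∈ Ioc (1 : ℝ) (M + 1)
  right_mem : qR ∈ Ioc (1 : ℝ) (M + 1)
  alpha_left : alpha M qL = concat a.length fun _ => a
  alpha_right : alpha M qR =
    concat a.length fun k => if k = 0 then plusWord a else reflectWord a

/-- The set `Ũ_q(J)` for the interval `J` generated by `a`: the sequences in `Ũ_q` with
prefix `a⁺`. -/
def tildeUJ {M : ℕ} (a : Word M) (q : ℝ) : Set (Seq M) :=
  {x | x ∈ tildeU M q ∧ (List.ofFn fun i : Fin a.length => x i) = plusWord a}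

/-- The vertices of the directed graph underlying the two automata. -/
inductive Vertex
  | start
  | A
  | B

/-- The edges of the directed graph: `XY` goes from `X` to `Y`. -/
inductive Edge
  | startA
  | AA
  | AB
  | BB
  | BA

/-- Source of an edge. -/
def Edge.src : Edge → Vertex
  | .startA => .start
  | .AA => .A
  | .AB => .A
  | .BB => .B
  | .BA => .B

/-- Target of an edge. -/
def Edge.tgt : Edge → Vertex
  | .startA => .A
  | .AA => .A
  | .AB => .B
  | .BB => .B
  | .BA => .A

/-- The label of an edge in `{a, a⁺, reflection of a, reflection of a⁺}`. -/
def Edge.label {M : ℕ} (a : Word M) : Edge → Word M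
  | .startA => plusWord a
  | .AA => reflectWord a
  | .AB => reflectWord (plusWord a)
  | .BB => a
  | .BA => plusWord a

/-- The reference label of an edge in `{0, 1}`. -/
def Edge.refLabel : Edge → Fin (1 + 1)
  | .startA => 1
  | .AA => 1
  | .AB => 0
  | .BB => 0
  | .BA => 1

/-- Infinite paths from the start vertex. -/
def IsPath (e : ℕ → Edge) : Prop :=
  (e 0).src = Vertex.start ∧ ∀ n, (e n).tgt = (e (n + 1)).src

/-- The sequence of digits read along the path `e`. -/
def readPath {M : ℕ} (a : Word M) (e : ℕ → Edge) : Seq M :=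
  concat a.length fun n => (e n).label a

/-- The set `X(J)` of sequences read along infinite paths from the start vertex. -/
def XJ {M : ℕ} (a : Word M) : Set (Seq M) := {x | ∃ e, IsPath e ∧ readPath a e = x}

/-- The block map `Φ_J` on `X(J)`: replace the labels along the path that spells `x` by the
reference labels, i.e. `a⁺` and the reflection of `a` by `1`, and `a` and the reflection of `a⁺`
by `0`. The path is unique for admissible `a`, since distinct edges out of a vertex have distinct
labels; values outside `X(J)` are irrelevant. -/
noncomputable def Phi {M : ℕ} (a : Word M) (x : Seq M) : Seq 1 :=
  haveI : Nonempty (ℕ → Edge) := ⟨fun _ => Edge.startA⟩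
  fun n => (Classical.epsilon (fun e : ℕ → Edge => IsPath e ∧ readPath a e = x) n).refLabel

/-- The induced map `(α*)⁻¹ ∘ Φ_J ∘ α`, where `α*` is `α` for the alphabet `{0, 1}`. -/
noncomputable def hatPhi {M : ℕ} (a : Word M) (q : ℝ) : ℝ :=
  Function.invFunOn (alpha 1) (Ioc (1 : ℝ) 2) (Phi a (alpha M q))

end UnivoqueBases

open UnivoqueBases

namespace UnivoqueBases

-- Everything becomes a lexicographic condition on quasi-greedy expansions. The map `alpha M` is
-- strictly increasing, and its values on `(1, M + 1]` are exactly the sequences with infinitely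
-- many nonzero digits that dominate all their shifts (`alpha_strictMonoOn`, `exists_alpha_eq`). A
-- base lies in 𝒱 iff all shifts of its expansion α also stay above the reflection of α
-- (`mem_bifV_iff`), and in 𝒰 iff α is `M^∞` or both inequalities are strict for every shift by `n ≥
-- 1` (`mem_univoqueBases_iff`).
--
-- A path in the graph is a 0-1 sequence rewritten in blocks of length `m`, each block depending on
-- its own reference label and on the preceding one, called the state below; this is `expand`. In
-- either state the two available blocks differ only in the last digit, where label 1 gives the
-- digit larger by one. Hence `expand` from a fixed state is strictly increasing, and reflection
-- merely exchanges the states. By admissibility, shifts that start inside a block satisfy the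
-- bounds automatically. At a block boundary in state 0 the comparison is that of the reference
-- sequences; in state 1 it is automatic for the expanded sequence and inherited from the previous
-- shift for the reference sequence. So the conditions defining Ũ, 𝒱 and 𝒰 pass through `expand`
-- unchanged (`BlockData.between_iff`, `BlockData.expand_mem_symShift_iff`,
-- `BlockData.isUnivoqueSeq_expand_iff`).
--
-- Conversely, a sequence that is at least `a^∞`, and whose shifts all lie between `α(q_R)` and its
-- reflection, can be decoded block by block (`BlockData.exists_eq_expand`). Thus the compact set
-- `symShift 1` parametrizes both `𝒱 ∩ (q_L, q_R]` and 𝒱*, which gives the homeomorphism; counting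
-- words gives the entropy.

local notation:50 x:51 "≺" y:51 => toLex x < toLex y
local notation:50 x:51 "≼" y:51 => toLex x ≤ toLex y

/-! ### Lexicographic order, shifts and reflection -/

section Lexicographic

variable {M : ℕ} {x y z : Seq M}

theorem lex_lt_iff : x ≺ y ↔ ∃ k, (∀ j < k, x j = y j) ∧ x k < y k := Iff.rfl

theorem lex_lt_cases (n : ℕ) (h : x ≺ y) :
    (∃ k < n, (∀ j < k, x j = y j) ∧ x k < y k) ∨
      ((∀ j < n, x j = y j) ∧ shift n x ≺ shift n y) := by
  obtain ⟨k, hk, hlt⟩ := h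
  by_cases hkn : k < n
  · exact Or.inl ⟨k, hkn, hk, hlt⟩
  · refine Or.inr ⟨fun j hj => hk j (by omega), k - n, fun j hj => hk (n + j) (by omega), ?_⟩
    simpa [shift, show n + (k - n) = k by omega] using hlt

theorem lex_lt_shift {n : ℕ} (h : ∀ j < n, x j = y j) :
    x ≺ y ↔ shift n x ≺ shift n y := by
  constructor
  · intro hxy
    rcases lex_lt_cases n hxy with ⟨k, hk, -, hlt⟩ | h'
    · exact absurd (h k hk) hlt.ne
    · exact h'.2
  · rintro ⟨k, hk, hlt⟩
    refine ⟨n + k, fun j hj => ?_, hlt⟩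
    by_cases hjn : j < n
    · exact h j hjn
    · have := hk (j - n) (by omega)
      simpa [shift, show n + (j - n) = j by omega] using this

theorem lex_le_shift {n : ℕ} (h : ∀ j < n, x j = y j) :
    x ≼ y ↔ shift n x ≼ shift n y := by
  exact not_lt.symm.trans ((not_congr (lex_lt_shift fun j hj => (h j hj).symm)).trans not_lt)

theorem lex_lt_of_head (h : x 0 < y 0) : x ≺ y := ⟨0, fun j hj => absurd hj (Nat.not_lt_zero j), h⟩

theorem head_le_of_lex_le (h : x ≼ y) : x 0 ≤ y 0 := by
  by_contra hc
  exact absurd (lex_lt_of_head (not_le.1 hc)) (not_lt.2 h)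

theorem reflect_reflect (x : Seq M) : reflect (reflect x) = x := by
  funext i; simp [reflect]

theorem reflect_lt_reflect : reflect x ≺ reflect y ↔ y ≺ x := by
  simp only [lex_lt_iff, reflect, Fin.rev_inj, Fin.rev_lt_rev]
  constructor <;> rintro ⟨k, hk, h⟩ <;> exact ⟨k, fun j hj => (hk j hj).symm, h⟩

theorem reflect_le_reflect : reflect x ≼ reflect y ↔ y ≼ x := by
  exact not_lt.symm.trans ((not_congr reflect_lt_reflect).trans not_lt)

theorem reflect_lt_comm : reflect x ≺ y ↔ reflect y ≺ x := by
  rw [← reflect_lt_reflect, reflect_reflect]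

theorem reflect_le_comm : reflect x ≼ y ↔ reflect y ≼ x := by
  rw [← reflect_le_reflect, reflect_reflect]

@[simp] theorem shift_zero (x : Seq M) : shift 0 x = x := by
  funext i; simp [shift]

theorem shift_shift (m n : ℕ) (x : Seq M) : shift m (shift n x) = shift (n + m) x := by
  funext i; simp [shift, Nat.add_assoc]

theorem shift_reflect (n : ℕ) (x : Seq M) : shift n (reflect x) = reflect (shift n x) := rfl

/-- A sequence squeezed between two sequences with a common prefix has the same prefix. -/
theorem eq_prefix_of_between {n : ℕ} (hxy : x ≼ y) (hyz : y ≼ z) (h : ∀ j < n, x j = z j) :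
    ∀ j < n, y j = x j := by
  rcases hxy.eq_or_lt with hxy | hxy
  · obtain rfl : x = y := hxy
    exact fun _ _ => rfl
  rcases lex_lt_cases n hxy with ⟨k, hk, hpre, hlt⟩ | h'
  · exfalso
    refine absurd hyz (not_le.2 (lex_lt_iff.2 ⟨k, fun j hj => ?_, ?_⟩))
    · rw [← hpre j hj, h j (hj.trans hk)]
    · rw [← h k hk]; exact hlt
  · exact fun j hj => (h'.1 j hj).symm

end Lexicographic

/-! ### Values of expansions in a fixed base -/

section Value

variable {M : ℕ} {q : ℝ} {x y α : Seq M}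

/-- `x` does not end with `0^∞`. -/
def Infinite0 (x : Seq M) : Prop := ¬ ∃ N, ∀ n ≥ N, x n = 0

theorem Infinite0.shift (h : Infinite0 x) (k : ℕ) : Infinite0 (UnivoqueBases.shift k x) := by
  rintro ⟨N, hN⟩
  refine h ⟨k + N, fun n hn => ?_⟩
  have := hN (n - k) (by omega)
  simpa [UnivoqueBases.shift, show k + (n - k) = n by omega] using this

theorem digit_le (x : Seq M) (i : ℕ) : ((x i : ℕ) : ℝ) ≤ M := by
  exact_mod_cast Nat.lt_succ_iff.1 (x i).isLt

theorem hasSum_bound (hq : 1 < q) : HasSum (fun i : ℕ => (M : ℝ) / q ^ (i + 1)) (M / (q - 1)) := by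
  have h := (hasSum_geometric_of_lt_one (inv_nonneg.2 (by linarith))
    (inv_lt_one_of_one_lt₀ hq)).mul_left ((M : ℝ) / q)
  have hq1 : q - 1 ≠ 0 := by linarith
  have hq0 : q ≠ 0 := by linarith
  have e1 : (M : ℝ) / q * (1 - q⁻¹)⁻¹ = M / (q - 1) := by field_simp
  have e2 : (fun i : ℕ => (M : ℝ) / q * q⁻¹ ^ i) = fun i => (M : ℝ) / q ^ (i + 1) := by
    funext i; rw [inv_pow, pow_succ]; field_simp
  rwa [e1, e2] at h

theorem summable_value (hq : 1 < q) (x : Seq M) :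
    Summable fun i : ℕ => ((x i : ℕ) : ℝ) / q ^ (i + 1) := by
  have hq0 : 0 < q := by linarith
  refine Summable.of_nonneg_of_le (fun i => by positivity) (fun i => ?_)
    (hasSum_bound (M := M) hq).summable
  exact div_le_div_of_nonneg_right (digit_le x i) (by positivity)

theorem value_nonneg (hq : 1 < q) (x : Seq M) : 0 ≤ value q x :=
  have hq0 : 0 < q := by linarith
  tsum_nonneg fun i => by positivity

theorem value_le (hq : 1 < q) (x : Seq M) : value q x ≤ M / (q - 1) := by
  have hq0 : 0 < q := by linarith
  rw [← (hasSum_bound hq).tsum_eq]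
  refine (summable_value hq x).tsum_le_tsum (fun i => ?_) (hasSum_bound hq).summable
  exact div_le_div_of_nonneg_right (digit_le x i) (by positivity)

theorem value_reflect (hq : 1 < q) (x : Seq M) :
    value q (reflect x) = M / (q - 1) - value q x := by
  have h := ((hasSum_bound (M := M) hq).sub (summable_value hq x).hasSum).tsum_eq
  rw [value, value, ← h]
  refine tsum_congr fun i => ?_
  rw [← sub_div, reflect, Fin.val_rev, Nat.cast_sub (by omega)]
  push_cast; ring

theorem value_succ (hq : 1 < q) (x : Seq M) :
    value q x = ((x 0 : ℕ) + value q (shift 1 x)) / q := by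
  have hq0 : q ≠ 0 := by linarith
  rw [value, (summable_value hq x).tsum_eq_zero_add, value, add_div, ← tsum_div_const]
  congr 1
  · simp
  · refine tsum_congr fun i => ?_
    rw [shift, div_div, ← pow_succ, add_comm 1 i]

theorem value_shift_succ (hq : 1 < q) (x : Seq M) (k : ℕ) :
    value q (shift k x) * q = (x k : ℕ) + value q (shift (k + 1) x) := by
  have hq0 : q ≠ 0 := by linarith
  rw [value_succ hq, shift_shift]
  field_simp
  simp [shift]

theorem value_sub_prefix (hq : 1 < q) {k : ℕ} (h : ∀ j < k, x j = y j) :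
    (value q x - value q y) * q ^ k = value q (shift k x) - value q (shift k y) := by
  induction k with
  | zero => simp
  | succ k ih =>
    have h1 := value_shift_succ hq x k
    have h2 := value_shift_succ hq y k
    have h3 := ih fun j hj => h j (by omega)
    rw [h k (by omega)] at h1
    rw [pow_succ, ← mul_assoc, h3]
    linarith

theorem value_sub (hq : 1 < q) {k : ℕ} (h : ∀ j < k, x j = y j) :
    (value q x - value q y) * q ^ (k + 1) =
      ((x k : ℕ) - (y k : ℕ)) + (value q (shift (k + 1) x) - value q (shift (k + 1) y)) := by
  have h1 := value_shift_succ hq x k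
  have h2 := value_shift_succ hq y k
  rw [pow_succ, ← mul_assoc, value_sub_prefix hq h]
  linarith

theorem digit_succ_le {c d : Fin (M + 1)} (h : c < d) : ((c : ℕ) : ℝ) + 1 ≤ (d : ℕ) := by
  exact_mod_cast h

theorem value_pos (hq : 1 < q) (hx : x ≠ 0) : 0 < value q x := by
  obtain ⟨i, hi⟩ := Function.ne_iff.1 hx
  have hq0 : 0 < q := by linarith
  refine (summable_value hq x).tsum_pos (fun j => by positivity) i ?_
  have : 0 < (x i : ℕ) := Nat.pos_of_ne_zero fun h => hi (Fin.ext h)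
  positivity

theorem Infinite0.ne_zero (h : Infinite0 x) : x ≠ 0 := fun h0 => h ⟨0, fun n _ => by rw [h0]; rfl⟩

theorem Infinite0.value_pos (h : Infinite0 x) (hq : 1 < q) : 0 < value q x :=
  UnivoqueBases.value_pos hq h.ne_zero

/-- Repeated improvement gives the bounds `max C 0 / q ^ N`, which tend to 0. This replaces a
supremum argument. -/
theorem le_zero_of_contracting {C : ℝ} (hq : 1 < q) {d : ℕ → ℝ} (hd : ∀ n, d n ≤ C)
    (hstep : ∀ B, 0 ≤ B → (∀ n, d n ≤ B) → ∀ n, d n ≤ B / q) (n : ℕ) : d n ≤ 0 := by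
  have hq0 : 0 < q := by linarith
  have key : ∀ N n, d n ≤ max C 0 / q ^ N := by
    intro N
    induction N with
    | zero => intro n; simpa using Or.inl (hd n)
    | succ N ih =>
      intro n
      have := hstep _ (by positivity) ih n
      rwa [div_div, ← pow_succ] at this
  have ht : Tendsto (fun N : ℕ => max C 0 / q ^ N) atTop (nhds 0) :=
    tendsto_const_nhds.div_atTop (tendsto_pow_atTop_atTop_of_one_lt hq)
  exact ge_of_tendsto' ht fun N => key N n

/-- At the first digit where a shift of `x` drops below `α` at least 1 is lost, so its excess over 1
is at most `q⁻¹` times the excess of a later shift. Bounded excesses that contract in this way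
cannot be positive. -/
theorem value_le_one_of_shift_le (hq : 1 < q) (hα : value q α = 1)
    (hx : ∀ n, shift n x ≼ α) : value q x ≤ 1 := by
  have hq0 : 0 < q := by linarith
  have := le_zero_of_contracting (C := M / (q - 1) - 1) hq
    (d := fun n => value q (shift n x) - 1) (fun n => by linarith [value_le hq (shift n x)]) ?_ 0
  · simpa using this
  intro B hB hd n
  rcases (hx n).eq_or_lt with h | h
  · have h : shift n x = α := h
    simp only [h, hα, sub_self]
    positivity
  · obtain ⟨k, hk, hlt⟩ := lex_lt_iff.1 h
    have h1 := value_sub hq hk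
    have h2 := hd (n + (k + 1))
    have h3 := digit_succ_le hlt
    have h4 := value_nonneg hq (shift (k + 1) α)
    rw [shift_shift, hα] at h1
    have h5 : (value q (shift n x) - 1) * q ^ (k + 1) ≤ B := by linarith
    have h6 : (value q (shift n x) - 1) ≤ B / q ^ (k + 1) := by rwa [le_div_iff₀ (by positivity)]
    refine h6.trans ?_
    gcongr
    exact le_self_pow₀ hq.le (by omega)

theorem value_lt_one_of_shift_le (hq : 1 < q) (hα : value q α = 1) (hinf : Infinite0 α)
    (hx : ∀ n, shift n x ≼ α) (hlt : x ≺ α) : value q x < 1 := by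
  have hq0 : 0 < q := by linarith
  obtain ⟨k, hk, hlt⟩ := lex_lt_iff.1 hlt
  have h1 := value_sub hq hk
  have h3 := digit_succ_le hlt
  have h4 := (hinf.shift (k + 1)).value_pos hq
  have h5 : value q (shift (k + 1) x) ≤ 1 :=
    value_le_one_of_shift_le hq hα fun n => by rw [shift_shift]; exact hx _
  by_contra hc
  have : 0 ≤ (value q x - value q α) * q ^ (k + 1) :=
    mul_nonneg (by linarith) (by positivity)
  linarith

/-- At the first difference `x` gains at least 1, while the tail of `α` given up there is worth at
most 1. -/
theorem one_le_value_of_le (hq : 1 < q) (hα : value q α = 1) (h1 : ∀ n, value q (shift n α) ≤ 1)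
    (hx : α ≼ x) : 1 ≤ value q x := by
  have hq0 : 0 < q := by linarith
  rcases hx.eq_or_lt with h | h
  · have h : α = x := h
    rw [← h, hα]
  · obtain ⟨k, hk, hlt⟩ := lex_lt_iff.1 h
    have h2 := value_sub hq hk
    have h3 := digit_succ_le hlt
    have h4 := h1 (k + 1)
    have h5 := value_nonneg hq (shift (k + 1) x)
    by_contra hc
    have : 0 < (value q α - value q x) * q ^ (k + 1) :=
      mul_pos (by linarith) (by positivity)
    linarith

theorem one_lt_value_of_lt (hq : 1 < q) (hα : value q α = 1) (h1 : ∀ n, value q (shift n α) ≤ 1)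
    (hpos : ∀ n, 0 < value q (shift n x)) (hx : α ≺ x) : 1 < value q x := by
  have hq0 : 0 < q := by linarith
  obtain ⟨k, hk, hlt⟩ := lex_lt_iff.1 hx
  have h2 := value_sub hq hk
  have h3 := digit_succ_le hlt
  have h4 := h1 (k + 1)
  have h5 := hpos (k + 1)
  by_contra hc
  have : 0 ≤ (value q α - value q x) * q ^ (k + 1) :=
    mul_nonneg (by linarith) (by positivity)
  linarith

/-- The quasi-greedy algorithm: every `t ∈ (0, M / (q - 1)]` has an expansion in base `q ≤ M + 1`
all of whose tails have positive value; for `t ≤ 1` all the tails have value at most `1`. -/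
theorem exists_expansion (hq : q ∈ Ioc (1 : ℝ) (M + 1)) {t : ℝ} (ht : 0 < t)
    (htM : t ≤ M / (q - 1)) : ∃ x : Seq M, value q x = t ∧
      (∀ n, 0 < value q (shift n x)) ∧ (t ≤ 1 → ∀ n, value q (shift n x) ≤ 1) := by
  obtain ⟨hq, hqM⟩ := hq
  have hq0 : 0 < q := by linarith
  have hq1 : 0 < q - 1 := by linarith
  -- The largest integer strictly below `q * s`, capped at `M`; strictness keeps all remainders
  -- positive, so the expansion cannot end in zeros.
  let dig : ℝ → ℕ := fun s => min M (⌈q * s⌉₊ - 1)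
  let r : ℕ → ℝ := fun n => Nat.rec t (fun _ s => q * s - dig s) n
  have hr : ∀ n, r (n + 1) = q * r n - dig (r n) := fun n => rfl
  have h1M : (1 : ℝ) ≤ M / (q - 1) := by rw [le_div_iff₀ hq1]; linarith
  have hceil : ∀ s : ℝ, 0 < s → ((⌈q * s⌉₊ - 1 : ℕ) : ℝ) < q * s ∧
      q * s ≤ ((⌈q * s⌉₊ - 1 : ℕ) : ℝ) + 1 := by
    intro s hs
    have hpos : 0 < q * s := by positivity
    have h1 := Nat.ceil_pos.2 hpos
    constructor
    · exact Nat.lt_ceil.1 (by omega)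
    · have := Nat.le_ceil (q * s)
      have h2 : ((⌈q * s⌉₊ : ℕ) : ℝ) = ((⌈q * s⌉₊ - 1 : ℕ) : ℝ) + 1 := by
        exact_mod_cast (Nat.sub_add_cancel h1).symm
      linarith
  have hstep : ∀ s : ℝ, 0 < s → 0 < q * s - dig s := by
    intro s hs
    have h1 := (hceil s hs).1
    have h2 : (dig s : ℝ) ≤ ((⌈q * s⌉₊ - 1 : ℕ) : ℝ) := by exact_mod_cast min_le_right _ _
    linarith
  have hstepM : ∀ s : ℝ, 0 < s → s ≤ M / (q - 1) → q * s - dig s ≤ M / (q - 1) := by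
    intro s hs hsM
    rcases le_total M (⌈q * s⌉₊ - 1) with h | h
    · have hd : dig s = M := min_eq_left h
      rw [hd]
      have : q * (M / (q - 1)) - M = M / (q - 1) := by field_simp; ring
      nlinarith
    · have hd : dig s = ⌈q * s⌉₊ - 1 := min_eq_right h
      rw [hd]
      linarith [(hceil s hs).2]
  have hstep1 : ∀ s : ℝ, 0 < s → s ≤ 1 → q * s - dig s ≤ 1 := by
    intro s hs hs1
    rcases le_total M (⌈q * s⌉₊ - 1) with h | h
    · have hd : dig s = M := min_eq_left h
      rw [hd]
      nlinarith
    · have hd : dig s = ⌈q * s⌉₊ - 1 := min_eq_right h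
      rw [hd]
      linarith [(hceil s hs).2]
  have hrpos : ∀ n, 0 < r n := fun n => by
    induction n with
    | zero => exact ht
    | succ n ih => rw [hr]; exact hstep _ ih
  have hrM : ∀ n, r n ≤ M / (q - 1) := fun n => by
    induction n with
    | zero => exact htM
    | succ n ih => rw [hr]; exact hstepM _ (hrpos n) ih
  let x : Seq M := fun n => ⟨dig (r n), Nat.lt_succ_iff.2 (min_le_left _ _)⟩
  have hrec : ∀ n, (value q (shift (n + 1) x) - r (n + 1)) = (value q (shift n x) - r n) * q := by
    intro n
    have := value_shift_succ hq x n
    have h2 : ((x n : ℕ) : ℝ) = dig (r n) := rfl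
    rw [hr, sub_mul, this, h2]
    ring
  have hval : ∀ n, value q (shift n x) = r n := by
    -- The error between tail value and remainder is multiplied by `q` at every step, yet stays
    -- bounded; hence it is 0.
    have hle := le_zero_of_contracting (C := 2 * (M / (q - 1))) hq
      (d := fun n => |value q (shift n x) - r n|) (fun n => by
        rw [abs_le]
        constructor <;> linarith [value_le hq (shift n x), value_nonneg hq (shift n x), hrpos n,
          hrM n]) (fun B hB h n => by
        have := h (n + 1)
        rw [hrec, abs_mul, abs_of_pos hq0] at this
        rwa [le_div_iff₀ hq0])
    intro n
    have := abs_nonpos_iff.1 (hle n)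
    linarith
  refine ⟨x, (congrArg (value q) (shift_zero x)).symm.trans (hval 0), fun n => by rw [hval]; exact hrpos n, fun ht1 n => ?_⟩
  rw [hval]
  induction n with
  | zero => exact ht1
  | succ n ih => rw [hr]; exact hstep1 _ (hrpos n) ih

end Value

/-! ### Quasi-greedy expansions of 1 -/

section Alpha

variable {M : ℕ} {q r : ℝ} {x y : Seq M}

/-- The sequences that occur as quasi-greedy expansions of `1`. -/
structure IsMaxShift (x : Seq M) : Prop where
  infinite : Infinite0 x
  shift_le : ∀ n, shift n x ≼ x

/-- A lexicographically larger sequence not ending in zeros has value greater than 1, so it is no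
competitor. -/
theorem isQuasiGreedy_of_shift_le (hq : 1 < q) (hx : IsMaxShift x) (h1 : value q x = 1) :
    IsQuasiGreedy q x := by
  refine ⟨⟨h1, hx.infinite⟩, fun y hy => ?_⟩
  by_contra hc
  have hlt : x ≺ ofLex y := not_le.1 hc
  have := one_lt_value_of_lt hq h1 (fun n => value_le_one_of_shift_le hq h1 fun k => by
    rw [shift_shift]; exact hx.shift_le _) (fun n => (Infinite0.shift hy.2 n).value_pos hq) hlt
  exact absurd hy.1 this.ne'

theorem exists_maxShift (hq : q ∈ Ioc (1 : ℝ) (M + 1)) :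
    ∃ x : Seq M, IsMaxShift x ∧ value q x = 1 := by
  have h1M : (1 : ℝ) ≤ M / (q - 1) := by
    rw [le_div_iff₀ (by linarith [hq.1])]; linarith [hq.2]
  obtain ⟨x, hx, hpos, hle⟩ := exists_expansion hq one_pos h1M
  refine ⟨x, ⟨?_, fun n => ?_⟩, hx⟩
  · rintro ⟨N, hN⟩
    have h0 : shift N x = 0 := funext fun i => hN _ (by omega)
    have h2 := hpos N
    rw [h0] at h2
    simp [value] at h2
  · by_contra hc
    have := one_lt_value_of_lt hq.1 hx (hle le_rfl)
      (fun k => by rw [shift_shift]; exact hpos _) (not_le.1 hc)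
    exact absurd (hle le_rfl n) (not_le.2 this)

theorem alpha_eq (hq : 1 < q) (hx : IsMaxShift x) (h1 : value q x = 1) : alpha M q = x := by
  have h := isQuasiGreedy_of_shift_le hq hx h1
  have h2 : IsQuasiGreedy q (alpha M q) := Classical.epsilon_spec (p := fun x => IsQuasiGreedy q x)
    ⟨x, h⟩
  exact toLex.injective (h2.unique h)

theorem alpha_isMaxShift (hq : q ∈ Ioc (1 : ℝ) (M + 1)) : IsMaxShift (alpha M q) := by
  obtain ⟨x, hx, h1⟩ := exists_maxShift hq
  rwa [alpha_eq hq.1 hx h1]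

theorem value_alpha (hq : q ∈ Ioc (1 : ℝ) (M + 1)) : value q (alpha M q) = 1 := by
  obtain ⟨x, hx, h1⟩ := exists_maxShift hq
  rwa [alpha_eq hq.1 hx h1]

theorem value_lt_value (hq : 1 < q) (hqr : q < r) (hx : x ≠ 0) : value r x < value q x := by
  have hq0 : 0 < q := by linarith
  obtain ⟨i, hi⟩ := Function.ne_iff.1 hx
  have hi : 0 < (x i : ℕ) := Nat.pos_of_ne_zero fun h => hi (Fin.ext h)
  refine Summable.tsum_lt_tsum (i := i) (fun j => ?_) ?_ (summable_value (hq.trans hqr) x)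
    (summable_value hq x)
  · gcongr
  · have : (0 : ℝ) < (x i : ℕ) := by exact_mod_cast hi
    gcongr

theorem value_le_value (hq : 1 < q) (hqr : q ≤ r) (x : Seq M) : value r x ≤ value q x := by
  rcases hqr.eq_or_lt with rfl | h
  · rfl
  by_cases hx : x = 0
  · simp [hx, value]
  · exact (value_lt_value hq h hx).le

/-- If `q < r` but `α(r) ≼ α(q)`, then every shift of `α(r)` is at most `α(q)`, so `α(r)` has value
at most 1 in base `q`; in the larger base `r` its value would be below 1. -/
theorem alpha_strictMonoOn :
    StrictMonoOn (fun q => toLex (alpha M q)) (Ioc (1 : ℝ) (M + 1)) := by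
  intro q hq r hr hqr
  by_contra hc
  have hle : alpha M r ≼ alpha M q := not_lt.1 hc
  have h1 := value_le_one_of_shift_le hq.1 (value_alpha hq)
    fun n => ((alpha_isMaxShift hr).shift_le n).trans hle
  have h2 := value_lt_value hq.1 hqr (alpha_isMaxShift hr).infinite.ne_zero
  rw [value_alpha hr] at h2
  linarith

theorem alpha_injOn : InjOn (alpha M) (Ioc (1 : ℝ) (M + 1)) := fun _ hq _ hr h =>
  alpha_strictMonoOn.injOn hq hr (congrArg toLex h)

theorem continuousOn_value (hq : 1 < q) (x : Seq M) :
    ContinuousOn (fun p => value p x) (Ici q) := by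
  have hq0 : 0 < q := by linarith
  refine continuousOn_tsum (u := fun i : ℕ => (M : ℝ) / q ^ (i + 1)) (fun i => ?_)
    (hasSum_bound hq).summable fun i p hp => ?_
  · refine continuousOn_const.div (by fun_prop) fun p hp => ?_
    have : 0 < p := hq0.trans_le hp
    positivity
  · have hp : q ≤ p := hp
    have : 0 < p := hq0.trans_le hp
    rw [Real.norm_of_nonneg (by positivity)]
    exact (div_le_div_of_nonneg_right (digit_le x i) (by positivity)).trans (by gcongr)

theorem exists_alpha_eq (hM : 1 ≤ M) (hx : IsMaxShift x) :
    ∃ q ∈ Ioc (1 : ℝ) (M + 1), alpha M q = x := by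
  have hM' : (1 : ℝ) ≤ M := by exact_mod_cast hM
  have hinf : ∀ N, ∃ n ≥ N, x n ≠ 0 := by
    intro N
    by_contra! h
    exact hx.infinite ⟨N, h⟩
  obtain ⟨i, -, hi⟩ := hinf 0
  obtain ⟨j, hij, hj⟩ := hinf (i + 1)
  have hone : ∀ k, x k ≠ 0 → (1 : ℝ) ≤ (x k : ℕ) := fun k hk => by
    exact_mod_cast Nat.pos_of_ne_zero fun h => hk (Fin.ext h)
  -- Two nonzero digits suffice to push the value above 1 for bases close to 1. In base `M + 1` it
  -- is at most 1, and the intermediate value theorem supplies `q`.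
  have hcont : ContinuousAt (fun p : ℝ => 1 / p ^ (i + 1) + 1 / p ^ (j + 1)) 1 := by
    refine ContinuousAt.add ?_ ?_ <;>
    exact continuousAt_const.div (by fun_prop) (by simp)
  have hev : ∀ᶠ p in nhds (1 : ℝ), 1 < 1 / p ^ (i + 1) + 1 / p ^ (j + 1) :=
    hcont.eventually (lt_mem_nhds (by norm_num))
  obtain ⟨p, hp, hp1, hpM⟩ := ((hev.filter_mono nhdsWithin_le_nhds).and
    (Ioo_mem_nhdsGT (show (1 : ℝ) < M + 1 by linarith))).exists
  have hp0 : 0 < p := by linarith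
  have hge : 1 ≤ value p x := by
    have h := (summable_value hp1 x).sum_le_tsum {i, j} fun k _ => by positivity
    rw [Finset.sum_pair (by omega)] at h
    have h1 : 1 / p ^ (i + 1) ≤ ((x i : ℕ) : ℝ) / p ^ (i + 1) := by gcongr; exact hone i hi
    have h2 : 1 / p ^ (j + 1) ≤ ((x j : ℕ) : ℝ) / p ^ (j + 1) := by gcongr; exact hone j hj
    simp only [value]
    linarith
  have hle : value (M + 1) x ≤ 1 := by
    refine (value_le (by linarith) x).trans (le_of_eq ?_)
    rw [add_sub_cancel_right, div_self (by linarith)]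
  obtain ⟨q, hq, hq1⟩ := intermediate_value_Icc' hpM.le
    ((continuousOn_value hp1 x).mono Icc_subset_Ici_self) ⟨hle, hge⟩
  exact ⟨q, ⟨by linarith [hq.1], hq.2⟩, alpha_eq (by linarith [hq.1]) hx hq1⟩

theorem infinite0_last (hM : 1 ≤ M) : Infinite0 (fun _ => Fin.last M : Seq M) := by
  rintro ⟨N, hN⟩
  have := hN N le_rfl
  simp [Fin.ext_iff] at this
  omega

theorem isMaxShift_last (hM : 1 ≤ M) : IsMaxShift (fun _ => Fin.last M : Seq M) :=
  ⟨infinite0_last hM, fun _ => le_rfl⟩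

theorem alpha_top (hM : 1 ≤ M) : alpha M (M + 1) = fun _ => Fin.last M := by
  have hM' : (1 : ℝ) ≤ M := by exact_mod_cast hM
  refine alpha_eq (by linarith) (isMaxShift_last hM) ?_
  have h := (hasSum_bound (M := M) (q := M + 1) (by linarith)).tsum_eq
  rw [add_sub_cancel_right, div_self (by linarith)] at h
  simpa [value] using h

end Alpha

/-! ### Lexicographic descriptions of 𝒱 and 𝒰 -/

section Bifurcation

variable {M : ℕ} {q r : ℝ} {x y : Seq M}

/-- The sequences all of whose shifts lie between their reflection and themselves. -/
def symShift (M : ℕ) : Set (Seq M) := {x | ∀ n, reflect x ≼ shift n x ∧ shift n x ≼ x}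

theorem infinite0_of_mem_symShift (hM : 1 ≤ M) (hx : x ∈ symShift M) : Infinite0 x := by
  rintro ⟨N, hN⟩
  have h0 : shift N x = 0 := funext fun i => hN _ (by omega)
  have h1 := (hx N).1
  rw [h0] at h1
  have h2 : reflect x = 0 := by
    by_contra hne
    obtain ⟨i, hi⟩ := Function.ne_iff.1 hne
    have hex : ∃ i, reflect x i ≠ 0 := ⟨i, hi⟩
    classical
    refine absurd h1 (not_le.2 (lex_lt_iff.2 ⟨Nat.find hex, fun j hj => ?_, ?_⟩))
    · exact (not_not.1 (Nat.find_min hex hj)).symm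
    · exact Fin.pos_of_ne_zero (Nat.find_spec hex)
  have h3 := congrFun h2 N
  simp only [reflect, hN N le_rfl, Pi.zero_apply, Fin.rev_zero, Fin.ext_iff, Fin.val_last,
    Fin.val_zero] at h3
  omega

theorem isMaxShift_of_mem_symShift (hM : 1 ≤ M) (hx : x ∈ symShift M) : IsMaxShift x :=
  ⟨infinite0_of_mem_symShift hM hx, fun n => (hx n).2⟩

theorem shift_mem_tildeU (hx : x ∈ tildeU M q) (k : ℕ) : shift k x ∈ tildeU M q := fun n => by
  rw [shift_shift]; exact hx _

theorem reflect_mem_tildeU (hx : x ∈ tildeU M q) : reflect x ∈ tildeU M q := fun n => by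
  rw [shift_reflect]
  exact ⟨reflect_lt_reflect.2 (hx n).2, reflect_lt_comm.1 (hx n).1⟩

theorem tildeU_mono (hq : q ∈ Ioc (1 : ℝ) (M + 1)) (hr : r ∈ Ioc (1 : ℝ) (M + 1)) (hqr : q ≤ r) :
    tildeU M q ⊆ tildeU M r := by
  intro x hx n
  have h : alpha M q ≼ alpha M r := alpha_strictMonoOn.monotoneOn hq hr hqr
  exact ⟨(reflect_le_reflect.2 h).trans_lt (hx n).1, (hx n).2.trans_le h⟩

/-- For the base `r` with `α(r) = c`, the gap applied to all shifts of a sequence in `Ũ_r` and to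
their reflections puts that sequence in `Ũ_q`. So `Ũ` is constant from `q` to `r`. -/
theorem not_mem_bifV_of_gap (hM : 1 ≤ M) (hq : q ∈ Ioc (1 : ℝ) (M + 1)) {c : Seq M}
    (hc : IsMaxShift c) (hlt : alpha M q ≺ c)
    (hgap : ∀ y, (∀ n, reflect c ≺ shift n y ∧ shift n y ≺ c) → y ≺ alpha M q) :
    q ∉ bifV M := by
  intro hV
  obtain ⟨r, hr, rfl⟩ := exists_alpha_eq hM hc
  have hqr : q < r := (alpha_strictMonoOn.lt_iff_lt hq hr).1 hlt
  refine hV.2 r ⟨hqr, hr.2⟩ (Subset.antisymm (fun x hx n => ?_) (tildeU_mono hq hr hqr.le))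
  have hs := shift_mem_tildeU hx n
  exact ⟨reflect_lt_comm.1 (hgap _ (reflect_mem_tildeU hs)), hgap _ hs⟩

/-- The sequence `(b b̄)^∞` where `b` is the prefix of `x` of length `n`. -/
def antiperiodic (n : ℕ) (x : Seq M) : Seq M := fun j =>
  if (j / n) % 2 = 0 then x (j % n) else (x (j % n)).rev

theorem shift_antiperiodic {n : ℕ} (hn : 0 < n) (x : Seq M) :
    shift n (antiperiodic n x) = reflect (antiperiodic n x) := by
  funext j
  simp only [shift, antiperiodic, reflect, Nat.add_mod_left, Nat.add_div_left j hn]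
  rcases Nat.mod_two_eq_zero_or_one (j / n) with h | h
  · rw [if_neg (by omega), if_pos h]
  · rw [if_pos (by omega), if_neg (by omega), Fin.rev_rev]

theorem antiperiodic_prefix {n j : ℕ} (h : j < n) (x : Seq M) : antiperiodic n x j = x j := by
  simp [antiperiodic, Nat.div_eq_of_lt h, Nat.mod_eq_of_lt h]

theorem infinite0_of_shift_eq_reflect (hM : 1 ≤ M) {n : ℕ} (h : shift n x = reflect x) :
    Infinite0 x := by
  rintro ⟨N, hN⟩
  have h1 := congrFun h N
  simp only [shift, reflect, hN N le_rfl, hN (n + N) (by omega), Fin.rev_zero, Fin.ext_iff,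
    Fin.val_last, Fin.val_zero] at h1
  omega

/-- Here `n` is the first shift at which `x` falls below its reflection. A violation by `(b b̄)^∞`
inside the prefix `b` would be one by `x`; a comparison that runs past `b` leads back, after
reflection, to an earlier one. -/
theorem antiperiodic_isMaxShift (hM : 1 ≤ M) (hx : ∀ n, shift n x ≼ x) {n : ℕ} (hn : 0 < n)
    (hmin : ∀ i < n, reflect x ≼ shift i x) (hlt : shift n x ≺ reflect x) :
    IsMaxShift (antiperiodic n x) := by
  set c := antiperiodic n x with hc
  have hcn : shift n c = reflect c := shift_antiperiodic hn x
  have hpre : ∀ j < n, c j = x j := fun j hj => antiperiodic_prefix hj x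
  refine ⟨infinite0_of_shift_eq_reflect hM hcn, fun i => ?_⟩
  -- Both bounds are proved together because shifting by `n` reflects `c` and so exchanges them.
  suffices H : ∀ i, reflect c ≼ shift i c ∧ shift i c ≼ c from (H i).2
  have hzero : reflect c ≼ c := by
    by_contra h
    rcases lex_lt_cases n (not_le.1 h) with ⟨k, hk, hk1, hk2⟩ | ⟨hk1, hk2⟩
    · refine absurd (hmin 0 hn) (not_le.2 ?_)
      rw [shift_zero]
      refine lex_lt_iff.2 ⟨k, fun j hj => ?_, ?_⟩
      · simpa [reflect, hpre j (hj.trans hk)] using hk1 j hj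
      · simpa [reflect, hpre k hk] using hk2
    · rw [shift_reflect, hcn, reflect_reflect] at hk2
      exact h hk2.le
  intro i
  induction i using Nat.strong_induction_on with
  | _ i ih =>
    by_cases hin : n ≤ i
    · have h := ih (i - n) (by omega)
      have e : shift i c = reflect (shift (i - n) c) := by
        rw [← shift_reflect, ← hcn, shift_shift, Nat.add_sub_cancel' hin]
      rw [e, reflect_le_reflect, reflect_le_comm]
      exact ⟨h.2, h.1⟩
    rcases Nat.eq_zero_or_pos i with rfl | hi0
    · rw [shift_zero]; exact ⟨hzero, le_rfl⟩
    have hin : i < n := not_le.1 hin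
    constructor
    · by_contra h
      rcases lex_lt_cases (n - i) (not_le.1 h) with ⟨k, hk, hk1, hk2⟩ | ⟨hk1, hk2⟩
      · refine absurd (hmin i hin) (not_le.2 (lex_lt_iff.2 ⟨k, fun j hj => ?_, ?_⟩))
        · simpa [reflect, shift, hpre j (by omega), hpre (i + j) (by omega)] using hk1 j hj
        · simpa [reflect, shift, hpre k (by omega), hpre (i + k) (by omega)] using hk2
      · have h1 : ∀ j < n - i, reflect x j = shift i x j := fun j hj => by
          simpa [reflect, shift, hpre j (by omega), hpre (i + j) (by omega)] using (hk1 j hj).symm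
        have h2 := (lex_le_shift h1).1 (hmin i hin)
        rw [shift_shift, show i + (n - i) = n by omega, shift_reflect] at h2
        exact absurd (hlt.trans_le (reflect_le_reflect.2 (hx (n - i)))) (not_lt.2 h2)
    · by_contra h
      rcases lex_lt_cases (n - i) (not_le.1 h) with ⟨k, hk, hk1, hk2⟩ | ⟨hk1, hk2⟩
      · refine absurd (hx i) (not_le.2 (lex_lt_iff.2 ⟨k, fun j hj => ?_, ?_⟩))
        · simpa [reflect, shift, hpre j (by omega), hpre (i + j) (by omega)] using hk1 j hj
        · simpa [reflect, shift, hpre k (by omega), hpre (i + k) (by omega)] using hk2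
      · rw [shift_shift, show i + (n - i) = n by omega, hcn] at hk2
        rcases lex_lt_cases i hk2 with ⟨k, hk, hk1, hk2⟩ | ⟨hk1, hk2⟩
        · refine absurd (hmin (n - i) (by omega)) (not_le.2 (lex_lt_iff.2 ⟨k, fun j hj => ?_, ?_⟩))
          · simpa [reflect, shift, hpre j (by omega), hpre (n - i + j) (by omega)] using hk1 j hj
          · simpa [reflect, shift, hpre k (by omega), hpre (n - i + k) (by omega)] using hk2
        · rw [shift_shift, show n - i + i = n by omega, hcn, shift_reflect,
            reflect_lt_reflect] at hk2
          exact h hk2.le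

theorem antiperiodic_one_isMaxShift (hM : 1 ≤ M) (hx : (x 0).rev ≤ x 0) :
    IsMaxShift (antiperiodic 1 x) := by
  have h1 : shift 1 (antiperiodic 1 x) = reflect (antiperiodic 1 x) :=
    shift_antiperiodic one_pos x
  refine ⟨infinite0_of_shift_eq_reflect hM h1, fun n => ?_⟩
  have hle : reflect (antiperiodic 1 x) ≼ antiperiodic 1 x := by
    rcases hx.eq_or_lt with h | h
    · refine le_of_eq (congrArg toLex (funext fun j => ?_))
      simp only [reflect, antiperiodic, Nat.mod_one, h, ite_self]
    · exact (lex_lt_of_head (by simpa [reflect, antiperiodic] using h)).le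
  have H : shift n (antiperiodic 1 x) = antiperiodic 1 x ∨
      shift n (antiperiodic 1 x) = reflect (antiperiodic 1 x) := by
    induction n with
    | zero => simp
    | succ n ih =>
      rw [← shift_shift]
      rcases ih with ih | ih <;> rw [ih]
      · exact Or.inr h1
      · rw [shift_reflect, h1, reflect_reflect]; exact Or.inl rfl
  rcases H with h | h <;> rw [h]
  exact hle

/-- If `α(q)` first violates the lower bound at shift `n ≥ 1`, with prefix `b` of length `n`, the
gap lies between `α(q)` and `c = (b b̄)^∞`: a sequence in it starts with `b`, and its shift by `n`
would drop below the reflection of `c`. Conversely, when all bounds hold, `α(q)` lies in `Ũ_r` for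
every `r > q` but not in `Ũ_q`. -/
theorem mem_bifV_iff (hM : 1 ≤ M) :
    q ∈ bifV M ↔ q ∈ Ioc (1 : ℝ) (M + 1) ∧ alpha M q ∈ symShift M := by
  constructor
  · intro hV
    have hq := hV.1
    refine ⟨hq, fun n => ⟨?_, (alpha_isMaxShift hq).shift_le n⟩⟩
    by_contra h
    have hex : ∃ n, shift n (alpha M q) ≺ reflect (alpha M q) := ⟨n, not_le.1 h⟩
    classical
    obtain ⟨n, hn, hmin⟩ : ∃ n, shift n (alpha M q) ≺ reflect (alpha M q) ∧
        ∀ i < n, reflect (alpha M q) ≼ shift i (alpha M q) :=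
      ⟨Nat.find hex, Nat.find_spec hex, fun i hi => not_lt.1 (Nat.find_min hex hi)⟩
    rcases Nat.eq_zero_or_pos n with rfl | hn0
    -- Here `α(q)` lies below its own reflection. With `c = (d d̄)^∞` the window has no admissible
    -- sequences at all: the first digit must be `d` or its reflection, and either choice makes the
    -- next shift leave the window.
    · rw [shift_zero] at hn
      -- the middle digit, rounded up
      let d : Fin (M + 1) := ⟨(M + 1) / 2, by omega⟩
      let c : Seq M := antiperiodic 1 fun _ => d
      have hc : IsMaxShift c := antiperiodic_one_isMaxShift hM (by
        simp only [Fin.le_def, Fin.val_rev, d]; omega)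
      have hc1 : shift 1 c = reflect c := shift_antiperiodic one_pos _
      have hcc : reflect c ≼ c := by rw [← hc1]; exact hc.shift_le 1
      have hlt : alpha M q ≺ c := by
        by_contra hle
        have hle := not_lt.1 hle
        exact absurd hn (not_lt.2 (((reflect_le_reflect.2 hle).trans hcc).trans hle))
      refine not_mem_bifV_of_gap hM hq hc hlt (fun y hy => ?_) hV
      exfalso
      have hy0 := hy 0
      have hy1 := hy 1
      rw [shift_zero] at hy0
      have b1 := head_le_of_lex_le hy0.1.le
      have b2 := head_le_of_lex_le hy0.2.le
      have c0 : c 0 = d := by simp [c, antiperiodic]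
      have c0' : reflect c 0 = d.rev := by rw [reflect, c0]
      rw [c0'] at b1
      rw [c0] at b2
      have hd : y 0 = d ∨ y 0 = d.rev := by
        simp only [Fin.le_def, Fin.ext_iff, Fin.val_rev, d] at *
        omega
      rcases hd with hd | hd
      · have := (lex_lt_shift (n := 1) (fun j hj => by
          obtain rfl : j = 0 := by omega
          rw [hd, c0])).1 hy0.2
        rw [hc1] at this
        exact absurd hy1.1 (not_lt.2 this.le)
      · have := (lex_lt_shift (n := 1) (fun j hj => by
          obtain rfl : j = 0 := by omega
          rw [hd, c0'])).1 hy0.1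
        rw [shift_reflect, hc1, reflect_reflect] at this
        exact absurd hy1.2 (not_lt.2 this.le)
    · have hα := alpha_isMaxShift hq
      have hc := antiperiodic_isMaxShift hM hα.shift_le hn0 hmin hn
      have hcn := shift_antiperiodic hn0 (alpha M q)
      have hpre : ∀ j < n, alpha M q j = antiperiodic n (alpha M q) j :=
        fun j hj => (antiperiodic_prefix hj _).symm
      have hlt : alpha M q ≺ antiperiodic n (alpha M q) := by
        by_contra hle
        have hle := not_lt.1 hle
        refine hle.not_gt ((lex_lt_shift hpre).2 ?_)
        rw [hcn]
        exact hn.trans_le (reflect_le_reflect.2 hle)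
      refine not_mem_bifV_of_gap hM hq hc hlt (fun y hy => ?_) hV
      by_contra hle
      have hle := not_lt.1 hle
      have hy0 := (hy 0).2
      rw [shift_zero] at hy0
      have hyp := eq_prefix_of_between hle hy0.le hpre
      have := (lex_lt_shift (fun j hj => (hyp j hj).trans (hpre j hj))).1 hy0
      rw [hcn] at this
      exact absurd this (not_lt.2 (hy n).1.le)
  · rintro ⟨hq, hα⟩
    refine ⟨hq, fun r hr h => ?_⟩
    have hr' : r ∈ Ioc (1 : ℝ) (M + 1) := ⟨hq.1.trans hr.1, hr.2⟩
    have hlt : alpha M q ≺ alpha M r := alpha_strictMonoOn hq hr' hr.1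
    have hmem : alpha M q ∈ tildeU M r := fun n =>
      ⟨(reflect_lt_reflect.2 hlt).trans_le (hα n).1, (hα n).2.trans_lt hlt⟩
    rw [h] at hmem
    have := (hmem 0).2
    rw [shift_zero] at this
    exact lt_irrefl _ this

/-- The condition characterizing the univoque bases below `M + 1`. -/
def IsUnivoqueSeq (x : Seq M) : Prop := ∀ n ≥ 1, reflect x ≺ shift n x ∧ shift n x ≺ x

/-- The shift by `n` is `M` followed by `x`, and it is at most `x`. So `x` starts with `M` and is at
most its own shift, hence fixed by the shift. -/
theorem eq_last_of_shift_eq (hx : ∀ n, shift n x ≼ x) {n : ℕ} (h : shift (n + 1) x = x)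
    (hn : x n = Fin.last M) : x = fun _ => Fin.last M := by
  have h0 := head_le_of_lex_le (hx n)
  have h0 : x 0 = Fin.last M := Fin.last_le_iff.1 (by simpa only [shift, Nat.add_zero, hn] using h0)
  have h1 : shift n x ≼ x := hx n
  have h2 := (lex_le_shift (n := 1) (fun j hj => by
    obtain rfl : j = 0 := by omega
    simp [shift, hn, h0])).1 h1
  rw [shift_shift, h] at h2
  have h3 : shift 1 x = x := toLex.injective (le_antisymm (hx 1) h2)
  funext j
  induction j with
  | zero => exact h0
  | succ j ih => exact ((congrArg x (add_comm j 1)).trans (congrFun h3 j)).trans ih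

/-- Replace the digits after position `k` by `y` and the digit at position `k` by `d`. -/
def splice (x : Seq M) (k : ℕ) (d : Fin (M + 1)) (y : Seq M) : Seq M := fun j =>
  if j < k then x j else if j = k then d else y (j - (k + 1))

theorem value_splice (hq : 1 < q) (x : Seq M) (k : ℕ) (d : Fin (M + 1)) (y : Seq M)
    (h : ((d : ℕ) : ℝ) + value q y = (x k : ℕ) + value q (shift (k + 1) x)) :
    value q (splice x k d y) = value q x := by
  have h1 : shift (k + 1) (splice x k d y) = y := by
    funext j
    have e1 : ¬ k + 1 + j < k := by omega
    have e2 : k + 1 + j ≠ k := by omega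
    simp [shift, splice, e1, e2]
  have h2 := value_sub (x := splice x k d y) (y := x) hq (k := k)
    (fun j hj => by simp [splice, hj])
  rw [h1, show splice x k d y k = d by simp [splice]] at h2
  have hq0 : 0 < q := by linarith
  have h3 : (value q (splice x k d y) - value q x) * q ^ (k + 1) = 0 := by rw [h2]; linarith
  have h4 : q ^ (k + 1) ≠ 0 := by positivity
  have := (mul_eq_zero.1 h3).resolve_right h4
  linarith

theorem splice_ne {k : ℕ} {d : Fin (M + 1)} (h : d ≠ x k) : splice x k d y ≠ x := fun e =>
  h (by rw [← congrFun e k]; simp [splice])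

/-- A violated inequality permits a second expansion of 1: change one digit by one and compensate in
the tail. -/
theorem isUnivoqueSeq_of_mem (hq : q ∈ univoqueBases M) (hne : q ≠ M + 1) (hM : 1 ≤ M) :
    IsUnivoqueSeq (alpha M q) := by
  obtain ⟨hq, x, hx, huniq⟩ := hq
  have hα := alpha_isMaxShift hq
  obtain rfl : alpha M q = x := huniq _ (value_alpha hq)
  have hM' : (1 : ℝ) ≤ M := by exact_mod_cast hM
  have hv1 : ∀ n, value q (shift n (alpha M q)) ≤ 1 := fun n =>
    value_le_one_of_shift_le hq.1 hx fun k => by rw [shift_shift]; exact hα.shift_le _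
  have hpos : ∀ n, alpha M q n ≠ 0 → reflect (alpha M q) ≺ shift (n + 1) (alpha M q) := by
    intro n hn
    by_contra h
    have h := not_lt.1 h
    have h1 : alpha M q ≼ reflect (shift (n + 1) (alpha M q)) := by
      rwa [← reflect_le_reflect, reflect_reflect]
    have h2 := one_le_value_of_le hq.1 hx hv1 h1
    rw [value_reflect hq.1] at h2
    have h3 := value_nonneg hq.1 (shift (n + 1) (alpha M q))
    -- Lowering digit `n` by one must be paid for by a tail worth 1 more; the failed inequality
    -- leaves exactly this room below `M / (q - 1)`.
    obtain ⟨y, hy, -⟩ := exists_expansion (t := value q (shift (n + 1) (alpha M q)) + 1) hq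
      (by linarith) (by linarith)
    have hn0 : 0 < (alpha M q n : ℕ) := Nat.pos_of_ne_zero fun h => hn (Fin.ext h)
    let d : Fin (M + 1) := ⟨(alpha M q n : ℕ) - 1, by omega⟩
    have hd : ((d : ℕ) : ℝ) + 1 = (alpha M q n : ℕ) := by
      exact_mod_cast Nat.sub_add_cancel hn0
    have h4 := value_splice hq.1 (alpha M q) n d y (by rw [hy]; linarith)
    refine splice_ne (fun h => ?_) (huniq _ (h4.trans hx))
    rw [h] at hd
    linarith
  have hlow : ∀ n, reflect (alpha M q) ≺ shift (n + 1) (alpha M q) := by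
    intro n
    induction n with
    | zero =>
      refine hpos 0 fun h0 => hα.infinite.ne_zero (funext fun j => ?_)
      have := head_le_of_lex_le (hα.shift_le j)
      rw [h0] at this
      exact Fin.le_zero_iff.1 this
    | succ n ih =>
      -- A zero digit cannot be lowered, but then a violation after it forces one before it.
      by_cases h0 : alpha M q (n + 1) = 0
      · by_contra h
        refine ih.not_ge ?_
        rcases (Fin.zero_le (reflect (alpha M q) 0)).eq_or_lt with he | hl
        · rw [lex_le_shift (n := 1) (fun j hj => by
            obtain rfl : j = 0 := by omega
            rw [← he, ← h0]; rfl), shift_shift, shift_reflect]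
          exact (not_lt.1 h).trans (reflect_le_reflect.2 (hα.shift_le 1))
        · exact (lex_lt_of_head (h0.trans_lt hl)).le
      · exact hpos _ h0
  intro n hn
  obtain ⟨n, rfl⟩ : ∃ k, n = k + 1 := ⟨n - 1, by omega⟩
  refine ⟨hlow n, lt_of_le_of_ne (hα.shift_le _) fun h => ?_⟩
  have h : shift (n + 1) (alpha M q) = alpha M q := h
  by_cases hl : alpha M q n = Fin.last M
  · have h1 := eq_last_of_shift_eq hα.shift_le h hl
    rw [← alpha_top hM] at h1
    exact hne (alpha_injOn hq ⟨by linarith, le_rfl⟩ h1)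
  · have hlt : (alpha M q n : ℕ) < M := Fin.val_lt_last hl
    let d : Fin (M + 1) := ⟨(alpha M q n : ℕ) + 1, by omega⟩
    have hd : ((d : ℕ) : ℝ) = (alpha M q n : ℕ) + 1 := by simp [d]
    -- A tail equal to `α` is worth exactly 1, so it can be traded for one more unit in digit `n`
    -- followed by zeros.
    have h4 := value_splice hq.1 (alpha M q) n d 0 (by rw [h, hx, hd]; simp [value])
    refine splice_ne (fun h => ?_) (huniq _ (h4.trans hx))
    rw [h] at hd
    linarith

/-- For sufficiency, compare another expansion with α at the first difference, where a digit changes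
by at least 1. Tails of α after a digit below `M` are worth less than 1, and so are reflected tails,
so the remaining digits cannot compensate in either direction. -/
theorem mem_univoqueBases_iff (hM : 1 ≤ M) :
    q ∈ univoqueBases M ↔ q ∈ Ioc (1 : ℝ) (M + 1) ∧
      ((alpha M q = fun _ => Fin.last M) ∨ IsUnivoqueSeq (alpha M q)) := by
  have hM' : (1 : ℝ) ≤ M := by exact_mod_cast hM
  constructor
  · intro hq
    refine ⟨hq.1, ?_⟩
    by_cases hne : q = M + 1
    · rw [hne]; exact Or.inl (alpha_top hM)
    · exact Or.inr (isUnivoqueSeq_of_mem hq hne hM)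
  rintro ⟨hq, h⟩
  have hα := alpha_isMaxShift hq
  have hq0 : 0 < q := by linarith [hq.1]
  have hup : ∀ k, alpha M q k < Fin.last M → value q (shift (k + 1) (alpha M q)) < 1 := by
    intro k hk
    rcases h with h | h
    · rw [h] at hk; exact absurd hk (lt_irrefl _)
    · exact value_lt_one_of_shift_le hq.1 (value_alpha hq) hα.infinite
        (fun n => by rw [shift_shift]; exact hα.shift_le _) (h (k + 1) (by omega)).2
  have hlow : ∀ k, value q (reflect (shift (k + 1) (alpha M q))) < 1 := by
    intro k
    rcases h with h | h
    · have : reflect (shift (k + 1) (alpha M q)) = 0 := by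
        rw [h]; funext j; simp [reflect, shift]
      rw [this]
      simp [value]
    · have hs : ∀ n, shift n (reflect (shift (k + 1) (alpha M q))) ≺ alpha M q := fun n => by
        rw [shift_reflect, shift_shift, reflect_lt_comm]
        exact (h _ (by omega)).1
      exact value_lt_one_of_shift_le hq.1 (value_alpha hq) hα.infinite (fun n => (hs n).le)
        (by simpa using hs 0)
  refine ⟨hq, alpha M q, value_alpha hq, fun y hy => ?_⟩
  have hy : value q y = 1 := hy
  by_contra hne
  rcases lt_or_gt_of_ne (fun h => hne (toLex.injective h) : toLex y ≠ toLex (alpha M q)) with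
    hlt | hlt
  · obtain ⟨k, hk, hlt⟩ := lex_lt_iff.1 hlt
    have h1 := value_sub hq.1 hk
    have h2 := digit_succ_le hlt
    have h3 := hlow k
    have h4 := value_le hq.1 (shift (k + 1) y)
    rw [value_reflect hq.1] at h3
    rw [hy, value_alpha hq, sub_self, zero_mul] at h1
    linarith
  · obtain ⟨k, hk, hlt⟩ := lex_lt_iff.1 hlt
    have h1 := value_sub hq.1 hk
    have h2 := digit_succ_le hlt
    have h3 := hup k (hlt.trans_le (Fin.le_last _))
    have h4 := value_nonneg hq.1 (shift (k + 1) y)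
    rw [hy, value_alpha hq, sub_self, zero_mul] at h1
    linarith

end Bifurcation

/-! ### The block substitution and its order properties -/

section Substitution

variable {M m : ℕ} {A P : ℕ → Fin (M + 1)}

/-- The properties of an admissible word of length `m` with digits `A i` such that `P i` are the
digits of the word whose last digit is increased by one. -/
structure BlockData (m : ℕ) (A P : ℕ → Fin (M + 1)) : Prop where
  pos : 0 < m
  plus_eq : ∀ j, j + 1 < m → P j = A j
  plus_last : (P (m - 1) : ℕ) = A (m - 1) + 1
  upper : ∀ i, 0 < i → i < m → ∃ k < m - i, (∀ j < k, A (i + j) = A j) ∧ A (i + k) < A k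
  lower : ∀ i, 0 < i → i < m → (∀ j < m - i, (A j).rev = A (i + j)) ∨
    ∃ k < m - i, (∀ j < k, (A j).rev = A (i + j)) ∧ (A k).rev < A (i + k)
  head : (A 0).rev < P 0

/-- The four blocks, indexed by the previous and the current reference label. -/
def blk (A P : ℕ → Fin (M + 1)) (p c : Fin (1 + 1)) (j : ℕ) : Fin (M + 1) :=
  if p = 0 then if c = 0 then A j else P j else if c = 0 then (P j).rev else (A j).rev

/-- The reference label preceding position `k` of `x`, the initial state being `p`. -/
def prevBit (p : Fin (1 + 1)) (x : Seq 1) : ℕ → Fin (1 + 1)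
  | 0 => p
  | k + 1 => x k

/-- The sequence of blocks with reference labels `x` read from the state `p`. -/
def expand (m : ℕ) (A P : ℕ → Fin (M + 1)) (p : Fin (1 + 1)) (x : Seq 1) : Seq M := fun n =>
  blk A P (prevBit p x (n / m)) (x (n / m)) (n % m)

theorem bit_cases (c : Fin (1 + 1)) : c = 0 ∨ c = 1 := by
  fin_cases c <;> simp

theorem rev_blk (p c : Fin (1 + 1)) (j : ℕ) :
    (blk A P p c j).rev = blk A P p.rev c.rev j := by
  rcases bit_cases p with rfl | rfl <;> rcases bit_cases c with rfl | rfl <;> simp [blk]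

theorem rev_prevBit (p : Fin (1 + 1)) (x : Seq 1) (k : ℕ) :
    (prevBit p x k).rev = prevBit p.rev (reflect x) k := by
  cases k <;> rfl

theorem reflect_expand (p : Fin (1 + 1)) (x : Seq 1) :
    reflect (expand m A P p x) = expand m A P p.rev (reflect x) := by
  funext n
  simp only [reflect, expand, rev_blk, rev_prevBit]

theorem prevBit_shift (p : Fin (1 + 1)) (x : Seq 1) (k l : ℕ) :
    prevBit (prevBit p x k) (shift k x) l = prevBit p x (k + l) := by
  cases l <;> rfl

theorem shift_expand (hm : 0 < m) (p : Fin (1 + 1)) (x : Seq 1) (k : ℕ) :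
    shift (m * k) (expand m A P p x) = expand m A P (prevBit p x k) (shift k x) := by
  funext n
  simp only [shift, expand, Nat.mul_add_mod, Nat.mul_add_div hm]
  congr 1
  exact (prevBit_shift p x k _).symm

theorem expand_apply (p : Fin (1 + 1)) (x : Seq 1) (k : ℕ) {i : ℕ} (hi : i < m) :
    expand m A P p x (m * k + i) = blk A P (prevBit p x k) (x k) i := by
  simp only [expand, Nat.mul_add_mod, Nat.mul_add_div (Nat.zero_lt_of_lt hi),
    Nat.div_eq_of_lt hi, Nat.mod_eq_of_lt hi, Nat.add_zero]

theorem expand_apply_lt (p : Fin (1 + 1)) (x : Seq 1) {i : ℕ} (hi : i < m) :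
    expand m A P p x i = blk A P p (x 0) i := by
  simpa [prevBit] using expand_apply p x 0 hi

theorem expand_congr {x y : Seq 1} (p : Fin (1 + 1)) {k n : ℕ} (h : ∀ j < k, x j = y j)
    (hn : n < m * k) : expand m A P p x n = expand m A P p y n := by
  have hk : n / m < k := Nat.div_lt_of_lt_mul hn
  have h2 : prevBit p x (n / m) = prevBit p y (n / m) := by
    cases hd : n / m with
    | zero => rfl
    | succ l => exact h l (by omega)
  simp only [expand, h _ hk, h2]

namespace BlockData

variable (D : BlockData m A P)
include D

theorem le_plus (j : ℕ) (hj : j < m) : A j ≤ P j := by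
  by_cases h : j + 1 < m
  · rw [D.plus_eq j h]
  · obtain rfl : j = m - 1 := by omega
    rw [Fin.le_def, D.plus_last]; omega

theorem last_lt : A (m - 1) < P (m - 1) := by
  rw [Fin.lt_def, D.plus_last]; omega

theorem blk_eq (p c c' : Fin (1 + 1)) {j : ℕ} (hj : j + 1 < m) : blk A P p c j = blk A P p c' j := by
  rcases bit_cases p with rfl | rfl <;> rcases bit_cases c with rfl | rfl <;>
  rcases bit_cases c' with rfl | rfl <;> simp [blk, D.plus_eq j hj]

/-- State 0 offers `a` and `a⁺`, state 1 offers the reflections of `a⁺` and `a`; in both cases label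
1 has the larger last digit. -/
theorem blk_last (p : Fin (1 + 1)) :
    (blk A P p 1 (m - 1) : ℕ) = blk A P p 0 (m - 1) + 1 := by
  have h := D.plus_last
  have h1 := (P (m - 1)).isLt
  rcases bit_cases p with rfl | rfl
  · simpa [blk] using h
  · simp only [blk, one_ne_zero, if_false, if_true, Fin.val_rev]
    omega

theorem blk_one_head_lt (c : Fin (1 + 1)) : blk A P 1 c 0 < P 0 := by
  have h := D.head
  have h1 := D.le_plus 0 D.pos
  rcases bit_cases c with rfl | rfl
  · simpa [blk] using (Fin.rev_le_rev.2 h1).trans_lt h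
  · simpa [blk] using h

theorem expand_lt {p : Fin (1 + 1)} {x y : Seq 1} (h : x ≺ y) :
    expand m A P p x ≺ expand m A P p y := by
  obtain ⟨k, hk, hlt⟩ := lex_lt_iff.1 h
  have hm := D.pos
  have hprev : prevBit p x k = prevBit p y k := by
    cases k with
    | zero => rfl
    | succ l => exact hk l (by omega)
  have hx : x k = 0 := by
    rcases bit_cases (x k) with h | h
    · exact h
    · have := (y k).isLt
      rw [h, Fin.lt_def] at hlt
      simp at hlt
      omega
  have hy : y k = 1 := by
    rcases bit_cases (y k) with h | h
    · rw [h] at hlt; exact absurd hlt (Fin.not_lt_zero _)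
    · exact h
  refine lex_lt_iff.2 ⟨m * k + (m - 1), fun n hn => ?_, ?_⟩
  · by_cases hnk : n < m * k
    · exact expand_congr p hk hnk
    · obtain ⟨i, rfl⟩ : ∃ i, n = m * k + i := ⟨n - m * k, by omega⟩
      rw [expand_apply p x k (by omega), expand_apply p y k (by omega), hprev]
      exact D.blk_eq _ _ _ (by omega)
  · rw [expand_apply p x k (by omega), expand_apply p y k (by omega), hprev, hx, hy, Fin.lt_def,
      D.blk_last]
    omega

theorem expand_lt_iff {p : Fin (1 + 1)} {x y : Seq 1} :
    expand m A P p x ≺ expand m A P p y ↔ x ≺ y := by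
  have h : StrictMono fun x : Lex (Seq 1) => toLex (expand m A P p (ofLex x)) :=
    fun _ _ hxy => D.expand_lt hxy
  exact h.lt_iff_lt (a := toLex x) (b := toLex y)

theorem expand_le_iff {p : Fin (1 + 1)} {x y : Seq 1} :
    expand m A P p x ≼ expand m A P p y ↔ x ≼ y :=
  not_lt.symm.trans ((not_congr D.expand_lt_iff).trans not_lt)

theorem expand_injective (p : Fin (1 + 1)) : Function.Injective (expand m A P p) := fun _ _ h =>
  toLex.injective (le_antisymm (D.expand_le_iff.1 (congrArg toLex h).le)
    (D.expand_le_iff.1 (congrArg toLex h).ge))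

/-- Both blocks leaving state 1 start with a digit smaller than the first digit of `a⁺`. -/
theorem expand_one_lt {x z : Seq 1} (hz : z 0 = 1) :
    expand m A P 1 x ≺ expand m A P 0 z := by
  refine lex_lt_of_head ?_
  rw [expand_apply_lt 1 x D.pos, expand_apply_lt 0 z D.pos, hz]
  exact D.blk_one_head_lt _

/-- Compare the tail of a block with the beginning of `P`. -/
theorem blk_tail {i : ℕ} (hi : 0 < i) (him : i < m) (p c : Fin (1 + 1)) :
    (∃ k < m - i, (∀ j < k, blk A P p c (i + j) = P j) ∧ blk A P p c (i + k) < P k) ∨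
      ((∀ j < m - i, blk A P p c (i + j) = P j) ∧ c = 1) := by
  have hP : ∀ j < m - i, P j = A j := fun j hj => D.plus_eq j (by omega)
  have hPi : ∀ j, j + 1 < m - i → P (i + j) = A (i + j) := fun j hj => D.plus_eq _ (by omega)
  rcases bit_cases p with rfl | rfl
  · obtain ⟨k, hk, hk1, hk2⟩ := D.upper i hi him
    rcases bit_cases c with rfl | rfl
    · refine Or.inl ⟨k, hk, fun j hj => ?_, ?_⟩
      · simpa [blk, hP j (hj.trans hk)] using hk1 j hj
      · simpa [blk, hP k hk] using hk2
    · have hk1' : ∀ j < k, blk A P 0 1 (i + j) = P j := fun j hj => by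
        simpa [blk, hP j (hj.trans hk), hPi j (by omega)] using hk1 j hj
      by_cases hkm : k + 1 < m - i
      · exact Or.inl ⟨k, hk, hk1', by simpa [blk, hP k hk, hPi k hkm] using hk2⟩
      · have hik : i + k = m - 1 := by omega
        have hl := D.plus_last
        rw [← hik] at hl
        have hle : P (i + k) ≤ P k := by
          rw [Fin.le_def, hl, hP k hk]; exact hk2
        rcases hle.eq_or_lt with he | hlt
        · refine Or.inr ⟨fun j hj => ?_, rfl⟩
          rcases Nat.lt_or_ge j k with hjk | hjk
          · exact hk1' j hjk
          · obtain rfl : j = k := by omega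
            simpa [blk] using he
        · exact Or.inl ⟨k, hk, hk1', by simpa [blk] using hlt⟩
  · have hc : (∀ j < m - i, (A (i + j)).rev = P j) ∨
        ∃ k < m - i, (∀ j < k, (A (i + j)).rev = P j) ∧ (A (i + k)).rev < P k := by
      rcases D.lower i hi him with h | ⟨k, hk, hk1, hk2⟩
      · exact Or.inl fun j hj => by rw [hP j hj, ← h j hj, Fin.rev_rev]
      · refine Or.inr ⟨k, hk, fun j hj => ?_, ?_⟩
        · rw [hP j (by omega), ← hk1 j hj, Fin.rev_rev]
        · rw [hP k hk, ← Fin.rev_lt_rev, Fin.rev_rev]; exact hk2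
    rcases bit_cases c with rfl | rfl
    · rcases hc with h | ⟨k, hk, hk1, hk2⟩
      · refine Or.inl ⟨m - 1 - i, by omega, fun j hj => ?_, ?_⟩
        · simpa [blk, hPi j (by omega)] using h j (by omega)
        · have e : i + (m - 1 - i) = m - 1 := by omega
          have := h (m - 1 - i) (by omega)
          rw [e] at this ⊢
          rw [← this]
          simpa [blk] using D.last_lt
      · refine Or.inl ⟨k, hk, fun j hj => ?_, ?_⟩
        · simpa [blk, hPi j (by omega)] using hk1 j hj
        · refine lt_of_le_of_lt ?_ hk2
          simpa [blk] using D.le_plus (i + k) (by omega)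
    · rcases hc with h | h
      · exact Or.inr ⟨fun j hj => by simpa [blk] using h j hj, rfl⟩
      · exact Or.inl (by simpa [blk] using h)

/-- Admissibility gives the weak inequality for `a`; raising the last digit makes it strict. -/
theorem rev_lt_tail {i : ℕ} (hi : 0 < i) (him : i < m) :
    ∃ k < i, (∀ j < k, (A j).rev = P (m - i + j)) ∧ (A k).rev < P (m - i + k) := by
  have hP : ∀ j, j + 1 < i → P (m - i + j) = A (m - i + j) := fun j hj => D.plus_eq _ (by omega)
  rcases D.lower (m - i) (by omega) (by omega) with h | ⟨k, hk, hk1, hk2⟩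
  · refine ⟨i - 1, by omega, fun j hj => ?_, ?_⟩
    · rw [hP j (by omega)]; exact h j (by omega)
    · rw [h (i - 1) (by omega), show m - i + (i - 1) = m - 1 by omega]
      exact D.last_lt
  · refine ⟨k, by omega, fun j hj => ?_, ?_⟩
    · rw [hP j (by omega)]; exact hk1 j hj
    · exact hk2.trans_le (D.le_plus _ (by omega))

/-- Inside a block the tail is either already smaller than the corresponding prefix of `a⁺`, or
equal to it with label 1. In the latter case the next block starts like the reflection of `a`, and
`rev_lt_tail` decides. So only block boundaries matter. -/
theorem shift_expand_lt {i : ℕ} (hi : 0 < i) (him : i < m) (p : Fin (1 + 1)) (x : Seq 1)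
    {z : Seq M} (hz : ∀ j < m, z j = P j) : shift i (expand m A P p x) ≺ z := by
  rcases D.blk_tail hi him p (x 0) with ⟨k, hk, hk1, hk2⟩ | ⟨h1, hx⟩
  · refine lex_lt_iff.2 ⟨k, fun j hj => ?_, ?_⟩
    · rw [shift, expand_apply_lt p x (by omega), hz j (by omega), hk1 j hj]
    · rw [shift, expand_apply_lt p x (by omega), hz k (by omega)]
      exact hk2
  · obtain ⟨k, hk, hk1, hk2⟩ := D.rev_lt_tail hi him
    have hnext : ∀ j < i, shift i (expand m A P p x) (m - i + j) = (A j).rev := fun j hj => by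
      rw [shift, show i + (m - i + j) = m * 1 + j by omega, expand_apply p x 1 (by omega),
        D.blk_eq _ _ 1 (by omega), prevBit, hx]
      simp [blk]
    refine lex_lt_iff.2 ⟨m - i + k, fun j hj => ?_, ?_⟩
    · rcases Nat.lt_or_ge j (m - i) with h | h
      · rw [shift, expand_apply_lt p x (by omega), hz j (by omega), h1 j h]
      · obtain ⟨l, rfl⟩ : ∃ l, j = m - i + l := ⟨j - (m - i), by omega⟩
        rw [hnext l (by omega), hz _ (by omega), hk1 l (by omega)]
    · rw [hnext k hk, hz _ (by omega)]
      exact hk2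

end BlockData

/-- Carries an upper bound across a label 1, that is, to the boundaries in state 1, where the
expanded sequence gives no information. -/
theorem shift_succ_le_of_one {x : Seq 1} {k : ℕ} (h : x k = 1) : shift (k + 1) x ≼ shift k x := by
  by_contra hc
  obtain ⟨j, hj, hlt⟩ := lex_lt_iff.1 (not_le.1 hc)
  have hone : ∀ l ≤ j, shift k x l = 1 := by
    intro l
    induction l with
    | zero => intro _; exact h
    | succ l ih =>
      intro hl
      have h1 := hj l (by omega)
      rw [ih (by omega)] at h1
      have e : k + (l + 1) = k + 1 + l := by omega
      rw [shift, e]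
      exact h1.symm
  rw [hone j le_rfl] at hlt
  have h2 := (shift (k + 1) x j).isLt
  rw [Fin.lt_def] at hlt
  simp at hlt
  omega

namespace BlockData

variable (D : BlockData m A P)
include D

omit D in
theorem expand_zero_prefix {z : Seq 1} (hz : z 0 = 1) : ∀ j < m, expand m A P 0 z j = P j :=
  fun j hj => by rw [expand_apply_lt 0 z hj, hz]; simp [blk]

/-- At boundaries in state 0, `expand` reflects the order. In state 1 the expanded bound is
automatic, and the reference bound follows from the previous shift, whose first label is 1. The
hypothesis `hp` covers an initial state 1, which has no previous label. -/
theorem shift_lt_iff {p : Fin (1 + 1)} {x z : Seq 1} (hz : z 0 = 1) (hp : p = 1 → x ≺ z) :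
    (∀ n, shift n (expand m A P p x) ≺ expand m A P 0 z) ↔ ∀ k, shift k x ≺ z := by
  have hblock : ∀ k, prevBit p x k = 0 →
      (shift (m * k) (expand m A P p x) ≺ expand m A P 0 z ↔ shift k x ≺ z) := fun k hk => by
    rw [shift_expand D.pos, hk, D.expand_lt_iff]
  constructor
  · intro h k
    induction k with
    | zero =>
      rcases bit_cases p with h0 | h1
      · exact (hblock 0 h0).1 (h _)
      · simpa using hp h1
    | succ k ih =>
      rcases bit_cases (x k) with h0 | h1
      · exact (hblock (k + 1) h0).1 (h _)
      · exact (shift_succ_le_of_one h1).trans_lt ih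
  · intro h n
    rw [← Nat.div_add_mod n m]
    rcases Nat.eq_zero_or_pos (n % m) with h0 | h0
    · rw [h0]
      rcases bit_cases (prevBit p x (n / m)) with hb | hb
      · exact (hblock _ hb).2 (h _)
      · rw [← shift_shift, shift_zero, shift_expand D.pos, hb]
        exact D.expand_one_lt hz
    · rw [← shift_shift, shift_expand D.pos]
      exact D.shift_expand_lt h0 (Nat.mod_lt _ D.pos) _ _ (expand_zero_prefix hz)

theorem shift_le_iff {p : Fin (1 + 1)} {x z : Seq 1} (hz : z 0 = 1) (hp : p = 1 → x ≼ z) :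
    (∀ n, shift n (expand m A P p x) ≼ expand m A P 0 z) ↔ ∀ k, shift k x ≼ z := by
  have hblock : ∀ k, prevBit p x k = 0 →
      (shift (m * k) (expand m A P p x) ≼ expand m A P 0 z ↔ shift k x ≼ z) := fun k hk => by
    rw [shift_expand D.pos, hk, D.expand_le_iff]
  constructor
  · intro h k
    induction k with
    | zero =>
      rcases bit_cases p with h0 | h1
      · exact (hblock 0 h0).1 (h _)
      · simpa using hp h1
    | succ k ih =>
      rcases bit_cases (x k) with h0 | h1
      · exact (hblock (k + 1) h0).1 (h _)
      · exact (shift_succ_le_of_one h1).trans ih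
  · intro h n
    rw [← Nat.div_add_mod n m]
    rcases Nat.eq_zero_or_pos (n % m) with h0 | h0
    · rw [h0]
      rcases bit_cases (prevBit p x (n / m)) with hb | hb
      · exact (hblock _ hb).2 (h _)
      · rw [← shift_shift, shift_zero, shift_expand D.pos, hb]
        exact (D.expand_one_lt hz).le
    · rw [← shift_shift, shift_expand D.pos]
      exact (D.shift_expand_lt h0 (Nat.mod_lt _ D.pos) _ _ (expand_zero_prefix hz)).le

omit D in
theorem reflect_lt_of_one {x z : Seq 1} (hx : x 0 = 1) (hz : z 0 = 1) : reflect x ≺ z :=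
  lex_lt_of_head (by rw [reflect, hx, hz]; decide)

/-- This is the upper bound for the reflected sequence, read from state 1. -/
theorem reflect_lt_shift_iff {x z : Seq 1} (hx : x 0 = 1) (hz : z 0 = 1) :
    (∀ n, reflect (expand m A P 0 z) ≺ shift n (expand m A P 0 x)) ↔
      ∀ k, reflect z ≺ shift k x := by
  have h := D.shift_lt_iff (p := 1) (x := reflect x) hz fun _ => reflect_lt_of_one hx hz
  rw [show (1 : Fin (1 + 1)) = Fin.rev 0 from rfl, ← reflect_expand] at h
  simpa only [shift_reflect, reflect_lt_comm (y := expand m A P 0 z), reflect_lt_comm (y := z)]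
    using h

theorem reflect_le_shift_iff {x z : Seq 1} (hx : x 0 = 1) (hz : z 0 = 1) :
    (∀ n, reflect (expand m A P 0 z) ≼ shift n (expand m A P 0 x)) ↔
      ∀ k, reflect z ≼ shift k x := by
  have h := D.shift_le_iff (p := 1) (x := reflect x) hz fun _ => (reflect_lt_of_one hx hz).le
  rw [show (1 : Fin (1 + 1)) = Fin.rev 0 from rfl, ← reflect_expand] at h
  simpa only [shift_reflect, reflect_le_comm (y := expand m A P 0 z), reflect_le_comm (y := z)]
    using h

theorem between_iff {x z : Seq 1} (hx : x 0 = 1) (hz : z 0 = 1) :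
    (∀ n, reflect (expand m A P 0 z) ≺ shift n (expand m A P 0 x) ∧
      shift n (expand m A P 0 x) ≺ expand m A P 0 z) ↔
      ∀ k, reflect z ≺ shift k x ∧ shift k x ≺ z := by
  rw [forall_and, forall_and, D.reflect_lt_shift_iff hx hz, D.shift_lt_iff hz (by simp)]

theorem expand_mem_symShift_iff {z : Seq 1} (hz : z 0 = 1) :
    expand m A P 0 z ∈ symShift M ↔ z ∈ symShift 1 := by
  simp only [symShift, mem_ofPred_eq]
  rw [forall_and, forall_and, D.reflect_le_shift_iff hz hz, D.shift_le_iff hz (by simp)]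

/-- Past the first block, the shifts are those of the expansion of `shift 1 z` from state 1, so
`shift_lt_iff` needs `shift 1 z ≺ z`. This fails only for `1^∞`, whose expansion `a⁺` followed by
reflected copies of `a` satisfies the strict inequalities directly. -/
theorem isUnivoqueSeq_expand_iff {z : Seq 1} (hz : z 0 = 1) :
    IsUnivoqueSeq (expand m A P 0 z) ↔ (z = fun _ => Fin.last 1) ∨ IsUnivoqueSeq z := by
  have hlow : (∀ n ≥ 1, reflect (expand m A P 0 z) ≺ shift n (expand m A P 0 z)) ↔
      ∀ n, reflect (expand m A P 0 z) ≺ shift n (expand m A P 0 z) := by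
    refine ⟨fun h n => ?_, fun h n _ => h n⟩
    rcases Nat.eq_zero_or_pos n with rfl | hn
    · rw [shift_zero, reflect_expand]
      exact D.expand_one_lt hz
    · exact h n hn
  have hlow' : (∀ n ≥ 1, reflect z ≺ shift n z) ↔ ∀ n, reflect z ≺ shift n z := by
    refine ⟨fun h n => ?_, fun h n _ => h n⟩
    rcases Nat.eq_zero_or_pos n with rfl | hn
    · rw [shift_zero]
      exact reflect_lt_of_one hz hz
    · exact h n hn
  have hup : (∀ n ≥ 1, shift n (expand m A P 0 z) ≺ expand m A P 0 z) ↔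
      ∀ n, shift n (expand m A P 1 (shift 1 z)) ≺ expand m A P 0 z := by
    have e : expand m A P 1 (shift 1 z) = shift m (expand m A P 0 z) := by
      have := shift_expand (A := A) (P := P) D.pos 0 z 1
      rw [Nat.mul_one, prevBit, hz] at this
      exact this.symm
    rw [e]
    refine ⟨fun h n => ?_, fun h n hn => ?_⟩
    · rw [shift_shift]; exact h _ (by have := D.pos; omega)
    · rcases Nat.lt_or_ge n m with hnm | hnm
      · exact D.shift_expand_lt hn hnm _ _ (expand_zero_prefix hz)
      · have := h (n - m)
        rwa [shift_shift, Nat.add_sub_cancel' hnm] at this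
  have hsplit : ∀ {N : ℕ} (x : Seq N), IsUnivoqueSeq x ↔
      (∀ n ≥ 1, reflect x ≺ shift n x) ∧ ∀ n ≥ 1, shift n x ≺ x := fun x =>
    ⟨fun h => ⟨fun n hn => (h n hn).1, fun n hn => (h n hn).2⟩,
      fun h n hn => ⟨h.1 n hn, h.2 n hn⟩⟩
  by_cases hall : z = fun _ => Fin.last 1
  · refine iff_of_true ?_ (Or.inl hall)
    rw [hsplit, hlow, hup, D.reflect_lt_shift_iff hz hz]
    refine ⟨fun k => ?_, fun n => ?_⟩
    · exact lex_lt_of_head (by rw [hall]; simp [reflect, shift])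
    · rw [← Nat.div_add_mod n m, ← shift_shift, shift_expand D.pos]
      have hb : prevBit 1 (shift 1 z) (n / m) = 1 := by
        cases n / m with
        | zero => rfl
        | succ l => rw [hall]; rfl
      rw [hb]
      rcases Nat.eq_zero_or_pos (n % m) with h0 | h0
      · rw [h0, shift_zero]; exact D.expand_one_lt hz
      · exact D.shift_expand_lt h0 (Nat.mod_lt _ D.pos) _ _ (expand_zero_prefix hz)
  · rw [or_iff_right hall, hsplit, hsplit, hlow, hlow', hup, D.reflect_lt_shift_iff hz hz]
    refine and_congr_right fun _ => ?_
    have hlt : shift 1 z ≺ z := by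
      refine lt_of_le_of_ne (by simpa using shift_succ_le_of_one hz) fun h => hall ?_
      have h : shift 1 z = z := h
      funext j
      induction j with
      | zero => exact hz
      | succ j ih => exact ((congrArg z (add_comm j 1)).trans (congrFun h j)).trans ih
    rw [D.shift_lt_iff hz fun _ => hlt]
    refine ⟨fun h n hn => ?_, fun h n => ?_⟩
    · have := h (n - 1)
      rwa [shift_shift, Nat.add_sub_cancel' hn] at this
    · rw [shift_shift]; exact h _ (by omega)

/-- A sequence lying in the window of a state starts with one of the two blocks leaving it. -/
theorem exists_block {s : Fin (1 + 1)} {Y : Seq M}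
    (h0 : expand m A P s 0 ≼ Y) (h1 : Y ≼ expand m A P s 1)
    (hl : expand m A P 1 0 ≼ shift m Y) (hu : shift m Y ≼ expand m A P 0 1) :
    ∃ c, (∀ i < m, Y i = blk A P s c i) ∧
      expand m A P c 0 ≼ shift m Y ∧ shift m Y ≼ expand m A P c 1 := by
  have hm := D.pos
  have hself : ∀ c : Fin (1 + 1), shift m (expand m A P s fun _ => c) =
      expand m A P c fun _ => c := fun c => by
    have := shift_expand (A := A) (P := P) D.pos s (fun _ => c) 1
    rw [Nat.mul_one] at this
    exact this
  have hpre := eq_prefix_of_between (n := m - 1) h0 h1 fun j hj => by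
    rw [expand_apply_lt s 0 (by omega), expand_apply_lt s 1 (by omega)]
    exact D.blk_eq _ _ _ (by omega)
  have hpre' : ∀ c, ∀ j < m - 1, Y j = blk A P s c j := fun c j hj => by
    rw [hpre j hj, expand_apply_lt s 0 (by omega)]
    exact D.blk_eq _ _ _ (by omega)
  have g0 := head_le_of_lex_le ((lex_le_shift fun j hj => (hpre j hj).symm).1 h0)
  have g1 := head_le_of_lex_le ((lex_le_shift fun j hj => by
    rw [hpre' 1 j hj, expand_apply_lt s 1 (by omega)]; rfl).1 h1)
  simp only [shift, Nat.add_zero] at g0 g1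
  rw [expand_apply_lt s 0 (by omega)] at g0
  rw [expand_apply_lt s 1 (by omega)] at g1
  have hlast := D.blk_last s
  have hex : ∃ c, Y (m - 1) = blk A P s c (m - 1) := by
    rcases (show (Y (m - 1) : ℕ) = blk A P s 0 (m - 1) ∨ (Y (m - 1) : ℕ) = blk A P s 1 (m - 1) by
      simp only [Fin.le_def, Pi.zero_apply, Pi.one_apply] at g0 g1
      omega) with h | h
    · exact ⟨0, Fin.ext h⟩
    · exact ⟨1, Fin.ext h⟩
  obtain ⟨c, hc⟩ := hex
  have hY : ∀ i < m, Y i = blk A P s c i := fun i hi => by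
    rcases Nat.lt_or_ge i (m - 1) with h | h
    · exact hpre' c i h
    · obtain rfl : i = m - 1 := by omega
      exact hc
  refine ⟨c, hY, ?_⟩
  -- One end of the next window is a global bound; the other is the corresponding bound on `Y` with
  -- the common block removed.
  rcases bit_cases c with rfl | rfl
  · refine ⟨?_, hu⟩
    have := (lex_le_shift (n := m) fun j hj => by
      rw [hY j hj, expand_apply_lt s 0 hj]; rfl).1 h0
    rwa [show shift m (expand m A P s 0) = expand m A P 0 0 from hself 0] at this
  · refine ⟨hl, ?_⟩
    have := (lex_le_shift (n := m) fun j hj => by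
      rw [hY j hj, expand_apply_lt s 1 hj]; rfl).1 h1
    rwa [show shift m (expand m A P s 1) = expand m A P 1 1 from hself 1] at this

/-- `expand m A P 0 1` is the expansion at the right endpoint and `expand m A P 1 0` its reflection.
These global bounds keep every block-boundary shift in the window of its state, so `exists_block`
can be iterated. -/
theorem exists_eq_expand {X : Seq M} (h0 : expand m A P 0 0 ≼ X)
    (hl : ∀ n, expand m A P 1 0 ≼ shift n X) (hu : ∀ n, shift n X ≼ expand m A P 0 1) :
    ∃ z, X = expand m A P 0 z := by
  let W : Fin (1 + 1) → Seq M → Prop := fun s Y =>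
    expand m A P s 0 ≼ Y ∧ Y ≼ expand m A P s 1
  have hstep : ∀ s k, ∃ c, W s (shift (m * k) X) →
      (∀ i < m, X (m * k + i) = blk A P s c i) ∧ W c (shift (m * (k + 1)) X) := by
    intro s k
    by_cases h : W s (shift (m * k) X)
    · obtain ⟨c, hc, hW⟩ := D.exists_block h.1 h.2 (by rw [shift_shift]; exact hl _)
        (by rw [shift_shift]; exact hu _)
      rw [shift_shift, ← Nat.mul_succ] at hW
      exact ⟨c, fun _ => ⟨hc, hW⟩⟩
    · exact ⟨0, fun h' => absurd h' h⟩
  choose f hf using hstep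
  let g : ℕ → Fin (1 + 1) := fun n => Nat.rec 0 (fun k s => f s k) n
  have hg : ∀ k, W (g k) (shift (m * k) X) := by
    intro k
    induction k with
    | zero => rw [Nat.mul_zero, shift_zero]; exact ⟨h0, shift_zero X ▸ hu 0⟩
    | succ k ih => exact (hf (g k) k ih).2
  refine ⟨fun k => g (k + 1), funext fun n => ?_⟩
  have hprev : ∀ k, prevBit 0 (fun k => g (k + 1)) k = g k := fun k => by cases k <;> rfl
  have h1 := (hf (g (n / m)) (n / m) (hg _)).1 (n % m) (Nat.mod_lt _ D.pos)
  rw [Nat.div_add_mod] at h1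
  rw [h1, expand, hprev]

/-- Otherwise the first label 1 is read from state 0, and the shift starting there exceeds the whole
sequence. -/
theorem head_eq_one_of_shift_le {z : Seq 1} (h0 : expand m A P 0 0 ≺ expand m A P 0 z)
    (hz : ∀ n, shift n (expand m A P 0 z) ≼ expand m A P 0 z) : z 0 = 1 := by
  obtain ⟨k, hk, hlt⟩ := lex_lt_iff.1 (D.expand_lt_iff.1 h0)
  rcases Nat.eq_zero_or_pos k with rfl | hk0
  · exact (bit_cases _).resolve_left (Fin.pos_iff_ne_zero.1 hlt)
  · exfalso
    have hprev : prevBit 0 z k = 0 := by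
      obtain ⟨l, rfl⟩ : ∃ l, k = l + 1 := ⟨k - 1, by omega⟩
      exact (hk l (by omega)).symm
    have h1 := hz (m * k)
    rw [shift_expand D.pos, hprev, D.expand_le_iff] at h1
    have h2 := head_le_of_lex_le h1
    rw [← hk 0 hk0] at h2
    exact absurd hlt (not_lt.2 h2)

end BlockData

end Substitution

/-! ### Admissible words and the automaton -/

section Words

variable {M : ℕ} {a : Word M}

/-- The digits of a word, extended by `0`. -/
def digits (w : Word M) (i : ℕ) : Fin (M + 1) := w.getD i 0

theorem digits_plusWord {j : ℕ} (hj : j < a.length) :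
    digits (plusWord a) j = if a.length - 1 = j then digits a j + 1 else digits a j := by
  have hj' : j < (plusWord a).length := by simpa [plusWord] using hj
  rw [digits, digits, List.getD_eq_getElem _ _ hj', List.getD_eq_getElem _ _ hj]
  simp only [plusWord, List.getElem_modify]

theorem digits_reflectWord {w : Word M} {j : ℕ} (hj : j < w.length) :
    digits (reflectWord w) j = (digits w j).rev := by
  have hj' : j < (reflectWord w).length := by simpa [reflectWord] using hj
  rw [digits, digits, List.getD_eq_getElem _ _ hj', List.getD_eq_getElem _ _ hj]
  simp only [reflectWord, List.getElem_map]

theorem length_plusWord (a : Word M) : (plusWord a).length = a.length := by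
  simp [plusWord]

theorem exists_digit_lt_of_lt {v w : Word M} (hl : v.length = w.length) (h : v < w) :
    ∃ k < v.length, (∀ j < k, digits v j = digits w j) ∧ digits v k < digits w k := by
  rw [List.lt_iff_exists] at h
  rcases h with h | ⟨k, h1, h2, hk, hlt⟩
  · omega
  · refine ⟨k, h1, fun j hj => ?_, ?_⟩
    · rw [digits, digits, List.getD_eq_getElem _ _ (hj.trans h1),
        List.getD_eq_getElem _ _ (hj.trans h2)]
      exact hk j hj
    · rw [digits, digits, List.getD_eq_getElem _ _ h1, List.getD_eq_getElem _ _ h2]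
      exact hlt

theorem digits_drop (w : Word M) (i j : ℕ) : digits (w.drop i) j = digits w (i + j) := by
  simp [digits, List.getD_eq_getElem?_getD]

theorem digits_take (w : Word M) {i j : ℕ} (h : j < i) : digits (w.take i) j = digits w j := by
  simp [digits, List.getD_eq_getElem?_getD, h]

theorem Admissible.upper (ha : Admissible a) {i : ℕ} (hi : 0 < i) (him : i < a.length) :
    ∃ k < a.length - i, (∀ j < k, digits a (i + j) = digits a j) ∧
      digits a (i + k) < digits a k := by
  rcases ha with ⟨-, h⟩ | ⟨-, d, rfl, -⟩
  · obtain ⟨k, hk, hk1, hk2⟩ := exists_digit_lt_of_lt (by simp) (h i hi him).2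
    rw [List.length_drop] at hk
    refine ⟨k, hk, fun j hj => ?_, ?_⟩
    · have := hk1 j hj
      rwa [digits_drop, digits_take _ (hj.trans hk)] at this
    · rwa [digits_drop, digits_take _ hk] at hk2
  · simp at him; omega

theorem Admissible.lower (ha : Admissible a) {i : ℕ} (hi : 0 < i) (him : i < a.length) :
    (∀ j < a.length - i, (digits a j).rev = digits a (i + j)) ∨
      ∃ k < a.length - i, (∀ j < k, (digits a j).rev = digits a (i + j)) ∧
        (digits a k).rev < digits a (i + k) := by
  rcases ha with ⟨-, h⟩ | ⟨-, d, rfl, -⟩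
  · have hd : ∀ j < a.length - i, digits (reflectWord (a.take (a.length - i))) j =
        (digits a j).rev := fun j hj => by
      rw [digits_reflectWord (by simp; omega), digits_take _ hj]
    have hlen : (reflectWord (a.take (a.length - i))).length = a.length - i := by
      simp [reflectWord]
    rcases (h i hi him).1.eq_or_lt with h | h
    · left
      intro j hj
      rw [← hd j hj, h, digits_drop]
    · right
      obtain ⟨k, hk, hk1, hk2⟩ := exists_digit_lt_of_lt (by simp [reflectWord]) h
      rw [hlen] at hk
      refine ⟨k, hk, fun j hj => ?_, ?_⟩
      · rw [← hd j (hj.trans hk), hk1 j hj, digits_drop]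
      · rwa [hd k hk, digits_drop] at hk2
  · simp at him; omega

theorem Admissible.length_pos (ha : Admissible a) : 0 < a.length := by
  rcases ha with ⟨h, -⟩ | ⟨-, d, rfl, -⟩
  · omega
  · simp

/-- Needed because `d + 1` in `Fin (M + 1)` would wrap around at `M`. -/
theorem Admissible.last_lt (ha : Admissible a) : digits a (a.length - 1) < Fin.last M := by
  have h0 := ha.length_pos
  by_cases h1 : a.length = 1
  · rcases ha with ⟨h, -⟩ | ⟨-, d, rfl, -, hd⟩
    · omega
    · simpa [digits] using hd
  · obtain ⟨k, hk, -, hlt⟩ := ha.upper (i := a.length - 1) (by omega) (by omega)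
    obtain rfl : k = 0 := by omega
    exact hlt.trans_le (Fin.le_last _)

theorem Admissible.blockData (ha : Admissible a) :
    BlockData a.length (digits a) (digits (plusWord a)) := by
  have h0 := ha.length_pos
  have hplus : (digits (plusWord a) (a.length - 1) : ℕ) = digits a (a.length - 1) + 1 := by
    rw [digits_plusWord (by omega), if_pos rfl, Fin.val_add_one_of_lt ha.last_lt]
  have heq : ∀ j, j + 1 < a.length → digits (plusWord a) j = digits a j := fun j hj => by
    rw [digits_plusWord (by omega), if_neg (by omega)]
  refine ⟨h0, heq, hplus, fun i => ha.upper, fun i => ha.lower, ?_⟩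
  by_cases h1 : a.length = 1
  · rcases ha with ⟨h, -⟩ | ⟨-, d, rfl, hd, -⟩
    · omega
    · refine lt_of_le_of_lt (b := d) (by simpa [digits] using hd) ?_
      rw [Fin.lt_def]
      have : (digits (plusWord [d]) 0 : ℕ) = d + 1 := hplus
      omega
  · rw [heq 0 (by omega)]
    obtain ⟨k, hk, -, hlt⟩ := ha.upper (i := a.length - 1) (by omega) (by omega)
    obtain rfl : k = 0 := by omega
    have hle : (digits a 0).rev ≤ digits a (a.length - 1) := by
      rcases ha.lower (i := a.length - 1) (by omega) (by omega) with h | ⟨k, hk, -, h⟩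
      · exact (h 0 (by omega)).le
      · obtain rfl : k = 0 := by omega
        exact h.le
    exact hle.trans_lt hlt

/-- The sequence spelled by the reference labels `z`, starting with `a⁺` if `z 0 = 1`. -/
def spell (a : Word M) (z : Seq 1) : Seq M :=
  expand a.length (digits a) (digits (plusWord a)) 0 z

/-- The reference label of the edges into a vertex, `0` for the start vertex. -/
def Vertex.bit : Vertex → Fin (1 + 1)
  | .start => 0
  | .A => 1
  | .B => 0

theorem Edge.digits_label (e : Edge) {i : ℕ} (hi : i < a.length) :
    digits (e.label a) i = blk (digits a) (digits (plusWord a)) e.src.bit e.refLabel i := by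
  cases e <;> simp [Edge.label, Edge.src, Edge.refLabel, Vertex.bit, blk, digits_reflectWord,
    length_plusWord, hi]

theorem IsPath.prevBit_eq {e : ℕ → Edge} (he : IsPath e) (k : ℕ) :
    prevBit 0 (fun n => (e n).refLabel) k = (e k).src.bit := by
  cases k with
  | zero => rw [he.1]; rfl
  | succ k =>
    rw [← he.2 k]
    change (e k).refLabel = _
    cases e k <;> rfl

theorem readPath_eq_spell (ha : 0 < a.length) {e : ℕ → Edge} (he : IsPath e) :
    readPath a e = spell a fun n => (e n).refLabel := by
  funext n
  rw [spell, expand, he.prevBit_eq, ← Edge.digits_label _ (Nat.mod_lt _ ha)]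
  rfl

/-- The edge between the states given by two consecutive reference labels. -/
def edgeOf (p c : Fin (1 + 1)) : Edge :=
  if p = 0 then if c = 0 then .BB else .BA else if c = 0 then .AB else .AA

/-- The path with prescribed reference labels. -/
def pathOf (z : Seq 1) : ℕ → Edge
  | 0 => .startA
  | k + 1 => edgeOf (z k) (z (k + 1))

theorem refLabel_pathOf {z : Seq 1} (hz : z 0 = 1) (k : ℕ) : (pathOf z k).refLabel = z k := by
  cases k with
  | zero => rw [hz]; rfl
  | succ k =>
    rw [pathOf]
    generalize z k = p
    generalize z (k + 1) = c
    rcases bit_cases p with rfl | rfl <;> rcases bit_cases c with rfl | rfl <;> rfl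

theorem isPath_pathOf {z : Seq 1} (hz : z 0 = 1) : IsPath (pathOf z) := by
  refine ⟨rfl, fun k => ?_⟩
  have h : (pathOf z k).tgt = if z k = 0 then Vertex.B else Vertex.A := by
    rw [← refLabel_pathOf hz k]
    cases pathOf z k <;> rfl
  rw [h, pathOf]
  generalize z k = p
  generalize z (k + 1) = c
  rcases bit_cases p with rfl | rfl <;> rcases bit_cases c with rfl | rfl <;> rfl

theorem spell_eq_readPath (ha : 0 < a.length) {z : Seq 1} (hz : z 0 = 1) :
    readPath a (pathOf z) = spell a z := by
  rw [readPath_eq_spell ha (isPath_pathOf hz)]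
  congr 1
  exact funext fun n => refLabel_pathOf hz n

theorem spell_mem_XJ (ha : 0 < a.length) {z : Seq 1} (hz : z 0 = 1) : spell a z ∈ XJ a :=
  ⟨pathOf z, isPath_pathOf hz, spell_eq_readPath ha hz⟩

/-- The path chosen in `Phi` spells the same sequence, and `expand` is injective, so its labels must
be `z`. -/
theorem Phi_spell (ha : Admissible a) {z : Seq 1} (hz : z 0 = 1) : Phi a (spell a z) = z := by
  have : Nonempty (ℕ → Edge) := ⟨fun _ => Edge.startA⟩
  have h := Classical.epsilon_spec
    (p := fun e : ℕ → Edge => IsPath e ∧ readPath a e = spell a z)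
    ⟨pathOf z, isPath_pathOf hz, spell_eq_readPath ha.length_pos hz⟩
  have h2 := h.2
  rw [readPath_eq_spell ha.length_pos h.1] at h2
  exact ha.blockData.expand_injective 0 h2

theorem concat_left (a : Word M) : (concat a.length fun _ => a) = spell a 0 := by
  funext n
  have h : prevBit 0 (0 : Seq 1) (n / a.length) = 0 := by cases n / a.length <;> rfl
  simp [concat, spell, expand, h, blk, digits]

theorem concat_right (ha : 0 < a.length) :
    (concat a.length fun k => if k = 0 then plusWord a else reflectWord a) = spell a 1 := by
  funext n
  have hr := digits_reflectWord (w := a) (Nat.mod_lt n ha)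
  rw [digits] at hr
  simp only [concat, spell, expand]
  cases n / a.length with
  | zero => simp [prevBit, blk, digits]
  | succ k =>
    simp only [Nat.succ_ne_zero, if_false, hr]
    simp [prevBit, blk]

theorem ofFn_eq_plusWord_iff {x : Seq M} :
    (List.ofFn fun i : Fin a.length => x i) = plusWord a ↔
      ∀ i < a.length, x i = digits (plusWord a) i := by
  constructor
  · intro h i hi
    rw [← h, digits, List.getD_eq_getElem _ _ (by simpa using hi)]
    simp
  · intro h
    refine List.ext_getElem (by simp [length_plusWord]) fun i h1 h2 => ?_
    have hi : i < a.length := by simpa using h1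
    have := h i hi
    rw [digits, List.getD_eq_getElem _ _ h2] at this
    simpa using this

end Words

/-! ### Compactness and continuity -/

section Topology

variable {M N : ℕ}

theorem continuous_shift (n : ℕ) : Continuous (shift n : Seq M → Seq M) :=
  continuous_pi fun i => continuous_apply (n + i)

theorem continuous_reflect : Continuous (reflect : Seq M → Seq M) :=
  continuous_pi fun i => continuous_of_discreteTopology.comp (continuous_apply i)

theorem isClosed_lex_le {X : Type*} [TopologicalSpace X] {f g : X → Seq M} (hf : Continuous f)
    (hg : Continuous g) : IsClosed {x | f x ≼ g x} := by
  rw [← isOpen_compl_iff, isOpen_iff_eventually]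
  intro x hx
  obtain ⟨k, hk, hlt⟩ := lex_lt_iff.1 (not_le.1 hx)
  have hev : ∀ {h : X → Seq M}, Continuous h → ∀ᶠ y in nhds x, ∀ j ∈ Iic k, h y j = h x j := by
    intro h hh
    rw [eventually_all_finite (finite_Iic k)]
    intro j _
    exact ((continuous_apply j).comp hh).continuousAt.eventually_mem
      ((isOpen_discrete {h x j}).mem_nhds rfl)
  filter_upwards [hev hf, hev hg] with y h1 h2
  refine not_le.2 (lex_lt_iff.2 ⟨k, fun j hj => ?_, ?_⟩)
  · rw [h1 j hj.le, h2 j hj.le, hk j hj]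
  · rw [h1 k self_mem_Iic, h2 k self_mem_Iic]; exact hlt

theorem isCompact_symShift (M : ℕ) : IsCompact (symShift M) := by
  refine IsClosed.isCompact ?_
  have : symShift M = ⋂ n, {x | reflect x ≼ shift n x} ∩ {x | shift n x ≼ x} := by
    ext x; simp [symShift]
  rw [this]
  exact isClosed_iInter fun n => (isClosed_lex_le continuous_reflect (continuous_shift n)).inter
    (isClosed_lex_le (continuous_shift n) continuous_id)

theorem continuous_expand (m : ℕ) (A P : ℕ → Fin (M + 1)) (p : Fin (1 + 1)) :
    Continuous (expand m A P p) := by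
  refine continuous_pi fun n => ?_
  have h : Continuous fun x : Seq 1 => (prevBit p x (n / m), x (n / m)) := by
    refine Continuous.prodMk ?_ (continuous_apply _)
    cases n / m with
    | zero => exact continuous_const
    | succ k => exact continuous_apply k
  exact (continuous_of_discreteTopology
    (f := fun c : Fin (1 + 1) × Fin (1 + 1) => blk A P c.1 c.2 (n % m))).comp h

theorem continuous_value {q : ℝ} (hq : 1 < q) : Continuous fun x : Seq M => value q x := by
  have hq0 : 0 < q := by linarith
  refine continuous_tsum (u := fun i : ℕ => (M : ℝ) / q ^ (i + 1)) (fun i => ?_)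
    (hasSum_bound hq).summable fun i x => ?_
  · exact (continuous_of_discreteTopology
      (f := fun c : Fin (M + 1) => ((c : ℕ) : ℝ) / q ^ (i + 1))).comp (continuous_apply i)
  · rw [Real.norm_of_nonneg (by positivity)]
    exact div_le_div_of_nonneg_right (digit_le x i) (by positivity)

/-- Bases whose quasi-greedy expansions are parametrized continuously and injectively by a compact
set are homeomorphic to that set. -/
theorem exists_homeomorph_of_alpha {K : Set (Seq N)} (hK : IsCompact K) {F : Seq N → Seq M}
    (hF : Continuous F) (hinj : InjOn F K) {S : Set ℝ} (hS : S ⊆ Ioc (1 : ℝ) (M + 1))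
    (hSK : ∀ q ∈ S, ∃ x ∈ K, alpha M q = F x) (hKS : ∀ x ∈ K, ∃ q ∈ S, alpha M q = F x) :
    ∃ e : K ≃ₜ S, ∀ x, alpha M (e x) = F x := by
  choose! f hfS hf using hKS
  let g : K → S := fun x => ⟨f x, hfS x x.2⟩
  have hbij : Function.Bijective g := by
    constructor
    · intro x y hxy
      have h : f x = f y := congrArg Subtype.val hxy
      refine Subtype.ext (hinj x.2 y.2 ?_)
      rw [← hf x x.2, ← hf y y.2, h]
    · intro q
      obtain ⟨x, hx, hq⟩ := hSK q q.2
      refine ⟨⟨x, hx⟩, Subtype.ext (alpha_injOn (hS (hfS x hx)) (hS q.2) ?_)⟩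
      rw [hf x hx, hq]
  have hval : ∀ x : K, value (f x) (F x) = 1 := fun x => by
    rw [← hf x x.2]; exact value_alpha (hS (hfS x x.2))
  have hne : ∀ x : K, F x ≠ 0 := fun x => by
    rw [← hf x x.2]; exact (alpha_isMaxShift (hS (hfS x x.2))).infinite.ne_zero
  have h1 : ∀ x : K, 1 < f x := fun x => (hS (hfS x x.2)).1
  -- For `b > 1`, comparing `f x` with `b` amounts to comparing 1 with the value of `F x` in base
  -- `b`, which is continuous in `x`.
  have hc : Continuous fun x : K => f x := by
    refine continuous_iff_continuousAt.2 fun x => tendsto_order.2 ⟨fun b hb => ?_, fun b hb => ?_⟩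
    · rcases le_or_gt b 1 with hb1 | hb1
      · exact Eventually.of_forall fun y => hb1.trans_lt (h1 y)
      · have hlt : 1 < value b (F x) := by
          rw [← hval x]; exact value_lt_value hb1 hb (hne x)
        have hcont : Continuous fun y : K => value b (F y) :=
          (continuous_value hb1).comp (hF.comp continuous_subtype_val)
        filter_upwards [hcont.continuousAt.eventually (lt_mem_nhds hlt)] with y hy
        by_contra hle
        have := value_le_value (h1 y) (not_lt.1 hle) (F y)
        rw [hval y] at this
        exact absurd hy (not_lt.2 this)
    · have hb1 : 1 < b := (h1 x).trans hb
      have hlt : value b (F x) < 1 := by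
        rw [← hval x]; exact value_lt_value (h1 x) hb (hne x)
      have hcont : Continuous fun y : K => value b (F y) :=
        (continuous_value hb1).comp (hF.comp continuous_subtype_val)
      filter_upwards [hcont.continuousAt.eventually (gt_mem_nhds hlt)] with y hy
      by_contra hle
      have := value_le_value hb1 (not_lt.1 hle) (F y)
      rw [hval y] at this
      exact absurd hy (not_lt.2 this)
  have : CompactSpace K := isCompact_iff_compactSpace.1 hK
  have hgc : Continuous (Equiv.ofBijective g hbij) := Continuous.subtype_mk hc _
  exact ⟨hgc.homeoOfEquivCompactToT2, fun x => hf x x.2⟩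

end Topology

/-! ### Counting words -/

section Entropy

variable {M m : ℕ} {A P : ℕ → Fin (M + 1)} {Y : Set (Seq 1)}

theorem blocks_nonempty {X : Set (Seq M)} (hX : X.Nonempty) (n : ℕ) : (blocks n X).Nonempty := by
  obtain ⟨x, hx⟩ := hX
  exact ⟨fun i => x (0 + i), x, hx, 0, fun _ => rfl⟩

theorem ncard_blocks_pos {X : Set (Seq M)} (hX : X.Nonempty) (n : ℕ) : 0 < (blocks n X).ncard :=
  (ncard_pos (toFinite _)).2 (blocks_nonempty hX n)

theorem ncard_blocks_add_le (X : Set (Seq M)) (k n : ℕ) :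
    (blocks (k + n) X).ncard ≤ (blocks k X).ncard * (blocks n X).ncard := by
  rw [← ncard_prod]
  refine ncard_le_ncard_of_injOn
    (fun w => (fun i => w (Fin.castAdd n i), fun i => w (Fin.natAdd k i))) ?_ ?_ (toFinite _)
  · rintro w ⟨x, hx, l, hw⟩
    refine ⟨⟨x, hx, l, fun i => hw _⟩, ⟨x, hx, l + k, fun i => ?_⟩⟩
    simp [hw, Nat.add_assoc]
  · intro w _ w' _ h
    simp only [Prod.mk.injEq] at h
    funext i
    refine Fin.addCases (fun j => congrFun h.1 j) (fun j => congrFun h.2 j) i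

theorem subadditive_log_ncard_blocks {X : Set (Seq M)} (hX : X.Nonempty) :
    Subadditive fun n => Real.log ((blocks n X).ncard : ℝ) := by
  intro k n
  have hk : (0 : ℝ) < (blocks k X).ncard := by exact_mod_cast ncard_blocks_pos hX k
  have hn : (0 : ℝ) < (blocks n X).ncard := by exact_mod_cast ncard_blocks_pos hX n
  have hkn : (0 : ℝ) < (blocks (k + n) X).ncard := by exact_mod_cast ncard_blocks_pos hX (k + n)
  simp only
  rw [← Real.log_mul hk.ne' hn.ne']
  refine Real.log_le_log hkn ?_
  exact_mod_cast ncard_blocks_add_le X k n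

/-- Fekete's lemma turns the `liminf` into a limit, so it can be evaluated along `n / m`. -/
theorem exists_tendsto_entropy {X : Set (Seq M)} (hX : X.Nonempty) :
    ∃ l, Tendsto (fun n : ℕ => Real.log ((blocks n X).ncard : ℝ) / n) atTop (nhds l) := by
  refine ⟨_, (subadditive_log_ncard_blocks hX).tendsto_lim ⟨0, ?_⟩⟩
  rintro _ ⟨n, rfl⟩
  exact div_nonneg (Real.log_natCast_nonneg _) (Nat.cast_nonneg _)

theorem entropy_empty : entropy (∅ : Set (Seq M)) = 0 := by
  simp [entropy, blocks]

/-- Extend a finite binary word by `0`. -/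
def padZero {L : ℕ} (w : Fin L → Fin (1 + 1)) : Seq 1 := fun j =>
  if h : j < L then w ⟨j, h⟩ else 0

/-- A word of length `n` is determined by its offset in a block, the state there and the reference
labels of the blocks it meets; the `+ 2` covers partial blocks at the ends. -/
theorem ncard_blocks_expand_le (hm : 0 < m) (p : Fin (1 + 1)) {Z : Set (Seq 1)} (hZ : Z ⊆ Y)
    (n : ℕ) :
    (blocks n (expand m A P p '' Z)).ncard ≤ 2 * m * (blocks (n / m + 2) Y).ncard := by
  let G : (Fin m × Fin (1 + 1)) × (Fin (n / m + 2) → Fin (1 + 1)) → (Fin n → Fin (M + 1)) :=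
    fun t j => expand m A P t.1.2 (padZero t.2) (t.1.1 + j)
  have hsub : blocks n (expand m A P p '' Z) ⊆ G '' (univ ×ˢ blocks (n / m + 2) Y) := by
    rintro w ⟨_, ⟨x, hx, rfl⟩, l, hw⟩
    refine ⟨((⟨l % m, Nat.mod_lt _ hm⟩, prevBit p x (l / m)), fun i => x (l / m + i)),
      ⟨mem_univ _, x, hZ hx, l / m, fun _ => rfl⟩, funext fun j => ?_⟩
    have h1 := congrFun (shift_expand (A := A) (P := P) hm p x (l / m)) (l % m + j)
    rw [shift, ← Nat.add_assoc, Nat.div_add_mod] at h1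
    rw [hw j, h1]
    refine expand_congr _ (k := n / m + 2) (fun i hi => ?_) ?_
    · simp [padZero, hi, shift]
    · have h2 := Nat.div_add_mod n m
      have h3 := Nat.mod_lt n hm
      have h4 := Nat.mod_lt l hm
      have h5 := j.isLt
      simp only [Nat.mul_add]
      omega
  refine (ncard_le_ncard hsub (toFinite _)).trans ((ncard_image_le (toFinite _)).trans ?_)
  rw [ncard_prod, ncard_univ]
  simp [mul_comm]

theorem BlockData.eq_of_expand_eq (D : BlockData m A P) {p : Fin (1 + 1)} {x y : Seq 1} {k : ℕ}
    (h : ∀ n < m * k, expand m A P p x n = expand m A P p y n) : ∀ j < k, x j = y j := by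
  intro j
  induction j using Nat.strong_induction_on with
  | _ j ih =>
    intro hj
    have hm := D.pos
    have hprev : prevBit p x j = prevBit p y j := by
      cases j with
      | zero => rfl
      | succ l => exact ih l (by omega) (by omega)
    have hlt : m * j + (m - 1) < m * k := by
      have : m * (j + 1) ≤ m * k := Nat.mul_le_mul_left m hj
      rw [Nat.mul_succ] at this
      omega
    have h1 := h _ hlt
    rw [expand_apply p x j (by omega), expand_apply p y j (by omega), hprev] at h1
    have h2 := D.blk_last (prevBit p y j)
    rcases bit_cases (x j) with hx | hx <;> rcases bit_cases (y j) with hy | hy <;>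
      rw [hx, hy] at h1 ⊢
    · rw [h1] at h2; omega
    · rw [h1] at h2; omega

/-- By shift invariance every word is a prefix, and reflection makes its first label 1; the factor 2
records whether reflection was used. -/
theorem BlockData.ncard_blocks_le (D : BlockData m A P) (hs : ∀ x ∈ Y, ∀ k, shift k x ∈ Y)
    (hr : ∀ x ∈ Y, reflect x ∈ Y) (n : ℕ) :
    (blocks (n / m) Y).ncard ≤
      2 * (blocks n (expand m A P 0 '' {x | x ∈ Y ∧ x 0 = 1})).ncard := by
  have hex : ∀ w : Fin (n / m) → Fin (1 + 1), ∃ x, w ∈ blocks (n / m) Y →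
      x ∈ Y ∧ ∀ i : Fin (n / m), w i = x i := by
    intro w
    by_cases hw : w ∈ blocks (n / m) Y
    · obtain ⟨x, hx, k, hk⟩ := hw
      exact ⟨shift k x, fun _ => ⟨hs x hx k, hk⟩⟩
    · exact ⟨0, fun h => absurd h hw⟩
  choose f hf using hex
  let g : Seq 1 → Seq 1 := fun x => if x 0 = 1 then x else reflect x
  have hg0 : ∀ x, g x 0 = 1 := fun x => by
    by_cases h : x 0 = 1
    · simp [g, h]
    · have : x 0 = 0 := (bit_cases _).resolve_right h
      simp [g, reflect, this]
  have hgY : ∀ x ∈ Y, g x ∈ Y := fun x hx => by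
    by_cases h : x 0 = 1
    · simpa [g, h] using hx
    · simpa [g, h] using hr x hx
  have hcard : 2 * (blocks n (expand m A P 0 '' {x | x ∈ Y ∧ x 0 = 1})).ncard =
      ((univ : Set (Fin (1 + 1))) ×ˢ
        blocks n (expand m A P 0 '' {x | x ∈ Y ∧ x 0 = 1})).ncard := by
    rw [ncard_prod, ncard_univ]; simp
  rw [hcard]
  refine ncard_le_ncard_of_injOn
    (fun w => (f w 0, fun i : Fin n => expand m A P 0 (g (f w)) i)) ?_ ?_ (toFinite _)
  · intro w hw
    refine ⟨mem_univ _, _, ⟨g (f w), ⟨hgY _ (hf w hw).1, hg0 _⟩, rfl⟩, 0, fun i => ?_⟩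
    simp
  · intro w hw w' hw' h
    simp only [Prod.mk.injEq] at h
    have hle : m * (n / m) ≤ n := Nat.mul_div_le n m
    have h1 : ∀ j < n / m, g (f w) j = g (f w') j := D.eq_of_expand_eq fun i hi =>
      congrFun h.2 ⟨i, hi.trans_le hle⟩
    funext i
    rw [(hf w hw).2, (hf w' hw').2]
    have h2 := h1 i i.isLt
    by_cases h0 : f w 0 = 1
    · simpa [g, ← h.1, h0] using h2
    · simpa [g, ← h.1, h0, reflect] using h2

theorem tendsto_div_div {u : ℕ → ℝ} {l : ℝ} (hm : 0 < m)
    (hu : Tendsto (fun n : ℕ => u n / n) atTop (nhds l)) :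
    Tendsto (fun n : ℕ => u (n / m) / n) atTop (nhds (l / m)) := by
  have h1 : Tendsto (fun n : ℕ => u (n / m) / ((n / m : ℕ) : ℝ)) atTop (nhds l) :=
    hu.comp (Nat.tendsto_div_const_atTop hm.ne')
  have h2 : Tendsto (fun n : ℕ => ((n / m : ℕ) : ℝ) / n) atTop (nhds (1 / m)) := by
    have h := (tendsto_nat_floor_mul_div_atTop (R := ℝ) (a := 1 / m) (by positivity)).comp
      tendsto_natCast_atTop_atTop
    refine h.congr fun n => ?_
    simp only [Function.comp]
    rw [one_div_mul_eq_div, Nat.floor_div_natCast, Nat.floor_natCast]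
  have h3 := h1.mul h2
  rw [mul_one_div] at h3
  refine h3.congr' ?_
  filter_upwards [eventually_ge_atTop m] with n hn
  have : ((n / m : ℕ) : ℝ) ≠ 0 := by
    have := Nat.div_pos hn hm
    positivity
  field_simp

/-- The logarithms of the word counts at lengths `n` and `n / m` differ by a bounded amount. -/
theorem BlockData.entropy_expand (D : BlockData m A P) (hs : ∀ x ∈ Y, ∀ k, shift k x ∈ Y)
    (hr : ∀ x ∈ Y, reflect x ∈ Y) :
    entropy (expand m A P 0 '' {x | x ∈ Y ∧ x 0 = 1}) = entropy Y / m := by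
  have hm := D.pos
  rcases Y.eq_empty_or_nonempty with rfl | hY
  · simp [entropy_empty]
  obtain ⟨l, hl⟩ := exists_tendsto_entropy hY
  have hXne : (expand m A P 0 '' {x | x ∈ Y ∧ x 0 = 1}).Nonempty := by
    obtain ⟨x, hx⟩ := hY
    rcases bit_cases (x 0) with h | h
    · exact ⟨_, reflect x, ⟨hr x hx, by simp [reflect, h]⟩, rfl⟩
    · exact ⟨_, x, ⟨hx, h⟩, rfl⟩
  set X := expand m A P 0 '' {x | x ∈ Y ∧ x 0 = 1} with hX
  have hb : ∀ n, (0 : ℝ) < (blocks n Y).ncard := fun n => by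
    exact_mod_cast ncard_blocks_pos hY n
  have hc : ∀ n, (0 : ℝ) < (blocks n X).ncard := fun n => by
    exact_mod_cast ncard_blocks_pos hXne n
  have hm' : (0 : ℝ) < m := by exact_mod_cast hm
  have hlow : ∀ n, Real.log (blocks (n / m) Y).ncard - Real.log 2 ≤
      Real.log (blocks n X).ncard := fun n => by
    rw [sub_le_iff_le_add', ← Real.log_mul two_ne_zero (hc n).ne']
    refine Real.log_le_log (hb _) ?_
    exact_mod_cast D.ncard_blocks_le hs hr n
  have hup : ∀ n, Real.log (blocks n X).ncard ≤ Real.log (blocks (n / m) Y).ncard +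
      (Real.log (2 * m) + Real.log (blocks 2 Y).ncard) := fun n => by
    have h1 : Real.log (blocks n X).ncard ≤
        Real.log (2 * m) + Real.log (blocks (n / m + 2) Y).ncard := by
      rw [← Real.log_mul (by positivity) (hb _).ne']
      refine Real.log_le_log (hc _) ?_
      exact_mod_cast ncard_blocks_expand_le hm 0 (sep_subset Y fun x => x 0 = 1) n
    have h2 := subadditive_log_ncard_blocks hY (n / m) 2
    simp only at h2
    linarith
  have hmain := tendsto_div_div hm hl
  have hconst : ∀ C : ℝ, Tendsto (fun n : ℕ => C / (n : ℝ)) atTop (nhds 0) := fun C =>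
    tendsto_const_nhds.div_atTop tendsto_natCast_atTop_atTop
  have hlim : Tendsto (fun n : ℕ => Real.log ((blocks n X).ncard : ℝ) / n) atTop
      (nhds (l / m)) := by
    have t1 := hmain.sub (hconst (Real.log 2))
    have t2 := hmain.add (hconst (Real.log (2 * m) + Real.log (blocks 2 Y).ncard))
    rw [sub_zero] at t1
    rw [add_zero] at t2
    refine tendsto_of_tendsto_of_tendsto_of_le_of_le t1 t2 (fun n => ?_) fun n => ?_
    · simp only
      rw [← sub_div]
      exact div_le_div_of_nonneg_right (hlow n) (Nat.cast_nonneg _)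
    · simp only
      rw [← add_div]
      exact div_le_div_of_nonneg_right (hup n) (Nat.cast_nonneg _)
  rw [entropy, entropy, hlim.liminf_eq, hl.liminf_eq]

end Entropy

/-! ### Transfer to the binary alphabet -/

section Renormalization

variable {M : ℕ} {a : Word M} {q qL qR : ℝ} {x : Seq M} {z : Seq 1}

theorem univoqueBases_subset_bifV (hM : 1 ≤ M) : univoqueBases M ⊆ bifV M := by
  intro q hU
  obtain ⟨hq, h⟩ := (mem_univoqueBases_iff hM).1 hU
  refine (mem_bifV_iff hM).2 ⟨hq, fun n => ⟨?_, (alpha_isMaxShift hq).shift_le n⟩⟩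
  rcases h with h | h
  · rw [h]
    refine not_lt.1 fun hlt => ?_
    obtain ⟨k, -, hk⟩ := lex_lt_iff.1 hlt
    simp [reflect, shift] at hk
  · rcases Nat.eq_zero_or_pos n with rfl | hn
    · rw [shift_zero]
      exact ((h 1 le_rfl).1.trans (h 1 le_rfl).2).le
    · exact (h n hn).1.le

theorem head_eq_one_of_mem_symShift (hz : z ∈ symShift 1) : z 0 = 1 := by
  have h := head_le_of_lex_le (hz 0).1
  rw [shift_zero] at h
  rcases bit_cases (z 0) with h0 | h0
  · rw [reflect, h0] at h
    exact absurd h (by decide)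
  · exact h0

namespace IsBasicInterval

variable (hJ : IsBasicInterval a qL qR)
include hJ

theorem alpha_left_eq : alpha M qL = spell a 0 := by
  rw [hJ.alpha_left, concat_left]

theorem alpha_right_eq : alpha M qR = spell a 1 := by
  rw [hJ.alpha_right, concat_right hJ.admissible.length_pos]

theorem mem_Ioc_iff (hq : q ∈ Ioc (1 : ℝ) (M + 1)) :
    q ∈ Ioc qL qR ↔ spell a 0 ≺ alpha M q ∧ alpha M q ≼ spell a 1 := by
  rw [← hJ.alpha_left_eq, ← hJ.alpha_right_eq]
  exact and_congr (alpha_strictMonoOn.lt_iff_lt hJ.left_mem hq).symm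
    (alpha_strictMonoOn.le_iff_le hq hJ.right_mem).symm

theorem exists_eq_spell (h0 : spell a 0 ≼ x)
    (hl : ∀ n, reflect (spell a 1) ≼ shift n x) (hu : ∀ n, shift n x ≼ spell a 1) :
    ∃ z, x = spell a z := by
  refine hJ.admissible.blockData.exists_eq_expand h0 (fun n => ?_) hu
  have h := hl n
  rwa [spell, reflect_expand] at h

theorem exists_symShift (hM : 1 ≤ M) (hq : q ∈ bifV M ∩ Ioc qL qR) :
    ∃ z ∈ symShift 1, z 0 = 1 ∧ alpha M q = spell a z := by
  obtain ⟨hq1, hsym⟩ := (mem_bifV_iff hM).1 hq.1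
  obtain ⟨hlt, hle⟩ := (hJ.mem_Ioc_iff hq1).1 hq.2
  obtain ⟨z, hz⟩ := hJ.exists_eq_spell hlt.le
    (fun n => (reflect_le_reflect.2 hle).trans (hsym n).1) (fun n => (hsym n).2.trans hle)
  rw [hz] at hlt hsym
  have hz0 := hJ.admissible.blockData.head_eq_one_of_shift_le hlt fun n => (hsym n).2
  exact ⟨z, (hJ.admissible.blockData.expand_mem_symShift_iff hz0).1 hsym, hz0, hz⟩

theorem exists_base (hM : 1 ≤ M) (hz : z ∈ symShift 1) :
    ∃ q ∈ bifV M ∩ Ioc qL qR, alpha M q = spell a z := by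
  have hz0 := head_eq_one_of_mem_symShift hz
  have D := hJ.admissible.blockData
  have hsym : spell a z ∈ symShift M := (D.expand_mem_symShift_iff hz0).2 hz
  obtain ⟨q, hq, hα⟩ := exists_alpha_eq hM (isMaxShift_of_mem_symShift hM hsym)
  refine ⟨q, ⟨(mem_bifV_iff hM).2 ⟨hq, hα ▸ hsym⟩, (hJ.mem_Ioc_iff hq).2 ?_⟩, hα⟩
  rw [hα]
  refine ⟨D.expand_lt (lex_lt_of_head ?_), D.expand_le_iff.2 (not_lt.1 fun h => ?_)⟩
  · rw [hz0]; decide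
  · obtain ⟨k, -, hk⟩ := lex_lt_iff.1 h
    exact absurd (Fin.le_last (z k)) (not_le.2 hk)

theorem hatPhi_spec (hM : 1 ≤ M) (hq : q ∈ bifV M ∩ Ioc qL qR) :
    ∃ z ∈ symShift 1, z 0 = 1 ∧ alpha M q = spell a z ∧ hatPhi a q ∈ bifV 1 ∧
      alpha 1 (hatPhi a q) = z := by
  obtain ⟨z, hz, hz0, hα⟩ := hJ.exists_symShift hM hq
  obtain ⟨p, hp, hpz⟩ := exists_alpha_eq le_rfl (isMaxShift_of_mem_symShift le_rfl hz)
  have e : Ioc (1 : ℝ) ((1 : ℕ) + 1) = Ioc 1 2 := by norm_num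
  have hex : ∃ p ∈ Ioc (1 : ℝ) 2, alpha 1 p = z := ⟨p, e ▸ hp, hpz⟩
  have h1 : hatPhi a q = Function.invFunOn (alpha 1) (Ioc (1 : ℝ) 2) z := by
    rw [hatPhi, hα, Phi_spell hJ.admissible hz0]
  have h2 : hatPhi a q ∈ Ioc (1 : ℝ) ((1 : ℕ) + 1) := by
    rw [h1, e]; exact Function.invFunOn_mem hex
  have h3 : alpha 1 (hatPhi a q) = z := by
    rw [h1]; exact Function.invFunOn_eq hex
  exact ⟨z, hz, hz0, hα, (mem_bifV_iff le_rfl).2 ⟨h2, h3.symm ▸ hz⟩, h3⟩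

theorem hatPhi_strictMonoOn (hM : 1 ≤ M) : StrictMonoOn (hatPhi a) (bifV M ∩ Ioc qL qR) := by
  intro q hq r hr hqr
  obtain ⟨z, -, -, hz, hp, hpz⟩ := hJ.hatPhi_spec hM hq
  obtain ⟨w, -, -, hw, hs, hsw⟩ := hJ.hatPhi_spec hM hr
  have h : alpha M q ≺ alpha M r := alpha_strictMonoOn hq.1.1 hr.1.1 hqr
  rw [hz, hw, spell, spell, hJ.admissible.blockData.expand_lt_iff, ← hpz, ← hsw] at h
  exact (alpha_strictMonoOn.lt_iff_lt hp.1 hs.1).1 h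

theorem exists_homeomorph (hM : 1 ≤ M) :
    ∃ e : ↥(bifV M ∩ Ioc qL qR) ≃ₜ ↥(bifV 1), ∀ q, (e q : ℝ) = hatPhi a (q : ℝ) := by
  have D := hJ.admissible.blockData
  obtain ⟨e₁, he₁⟩ := exists_homeomorph_of_alpha (M := 1) (isCompact_symShift 1) continuous_id
    (injOn_id _) (S := bifV 1) (fun q hq => hq.1)
    (fun q hq => ⟨_, ((mem_bifV_iff le_rfl).1 hq).2, rfl⟩) fun x hx => by
      obtain ⟨p, hp, hpx⟩ := exists_alpha_eq le_rfl (isMaxShift_of_mem_symShift le_rfl hx)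
      exact ⟨p, (mem_bifV_iff le_rfl).2 ⟨hp, hpx.symm ▸ hx⟩, hpx⟩
  obtain ⟨e₂, he₂⟩ := exists_homeomorph_of_alpha (M := M) (isCompact_symShift 1)
    (F := spell a) (continuous_expand _ _ _ _) (D.expand_injective 0).injOn
    (S := bifV M ∩ Ioc qL qR) (fun q hq => hq.1.1)
    (fun q hq => by
      obtain ⟨z, hz, -, hα⟩ := hJ.exists_symShift hM hq
      exact ⟨z, hz, hα⟩) fun z hz => hJ.exists_base hM hz
  refine ⟨e₂.symm.trans e₁, fun q => ?_⟩
  obtain ⟨z, -, -, hα, hp, hpz⟩ := hJ.hatPhi_spec hM q.2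
  have h1 := he₂ (e₂.symm q)
  rw [e₂.apply_symm_apply, hα] at h1
  have h2 : z = e₂.symm q := D.expand_injective 0 h1
  have h3 := he₁ (e₂.symm q)
  rw [← h2, id, ← hpz] at h3
  exact alpha_injOn (e₁ (e₂.symm q)).2.1 hp.1 h3

/-- Only `q_L` has to be excluded: its expansion `a^∞` is periodic and is not `M^∞`, since the last
letter of `a` is below `M`. -/
theorem univoqueBases_inter_Icc_subset (hM : 1 ≤ M) :
    univoqueBases M ∩ Icc qL qR ⊆ bifV M ∩ Ioc qL qR := by
  rintro q ⟨hU, hqJ⟩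
  obtain ⟨hq, h⟩ := (mem_univoqueBases_iff hM).1 hU
  refine ⟨univoqueBases_subset_bifV hM hU, lt_of_le_of_ne hqJ.1 ?_, hqJ.2⟩
  rintro rfl
  have hper : shift a.length (alpha M qL) = alpha M qL := by
    rw [hJ.alpha_left_eq]
    have := shift_expand (A := digits a) (P := digits (plusWord a))
      hJ.admissible.length_pos 0 0 1
    rw [Nat.mul_one] at this
    exact this
  rcases h with h | h
  · have hlt : digits a (a.length - 1) < Fin.last M := hJ.admissible.last_lt
    have h1 := congrFun h (a.length - 1)
    have h0 := hJ.admissible.length_pos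
    rw [hJ.alpha_left_eq, spell, expand_apply_lt 0 0 (by omega)] at h1
    simp only [blk, Pi.zero_apply, if_true] at h1
    exact absurd h1 hlt.ne
  · have h1 := (h a.length hJ.admissible.length_pos).2
    rw [hper] at h1
    exact lt_irrefl _ h1

theorem hatPhi_mem_univoqueBases_iff (hM : 1 ≤ M) (hq : q ∈ bifV M ∩ Ioc qL qR) :
    hatPhi a q ∈ univoqueBases 1 ↔ q ∈ univoqueBases M := by
  obtain ⟨z, -, hz0, hα, hp, hpz⟩ := hJ.hatPhi_spec hM hq
  have D := hJ.admissible.blockData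
  rw [mem_univoqueBases_iff hM, mem_univoqueBases_iff le_rfl, and_iff_right hq.1.1,
    and_iff_right hp.1, hpz, hα, spell, D.isUnivoqueSeq_expand_iff hz0]
  -- The alternative `M^∞` is impossible, since shifting the expansion by one block makes it
  -- strictly smaller.
  refine (or_iff_right fun h => ?_).symm
  have h1 := D.expand_one_lt (x := shift 1 z) hz0
  have h2 := shift_expand (A := digits a) (P := digits (plusWord a)) D.pos 0 z 1
  rw [prevBit, hz0] at h2
  rw [← h2, h] at h1
  exact lt_irrefl _ h1

theorem image_univoqueBases (hM : 1 ≤ M) :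
    hatPhi a '' (univoqueBases M ∩ Icc qL qR) = univoqueBases 1 := by
  ext p
  constructor
  · rintro ⟨q, hq, rfl⟩
    exact (hJ.hatPhi_mem_univoqueBases_iff hM (hJ.univoqueBases_inter_Icc_subset hM hq)).2 hq.1
  · intro hp
    have hpV : p ∈ bifV 1 := univoqueBases_subset_bifV le_rfl hp
    obtain ⟨e, he⟩ := hJ.exists_homeomorph hM
    have hq := (e.symm ⟨p, hpV⟩).2
    have hqp : hatPhi a (e.symm ⟨p, hpV⟩) = p := by rw [← he, e.apply_symm_apply]
    refine ⟨_, ⟨(hJ.hatPhi_mem_univoqueBases_iff hM hq).1 (hqp.symm ▸ hp),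
      Ioc_subset_Icc_self hq.2⟩, hqp⟩

theorem tildeUJ_eq (hM : 1 ≤ M) (hq : q ∈ bifV M ∩ Ioc qL qR) :
    tildeUJ a q = spell a '' {x | x ∈ tildeU 1 (hatPhi a q) ∧ x 0 = 1} := by
  obtain ⟨z, -, hz0, hα, hp, hpz⟩ := hJ.hatPhi_spec hM hq
  have D := hJ.admissible.blockData
  have hiff : ∀ w : Seq 1, w 0 = 1 →
      (spell a w ∈ tildeU M q ↔ w ∈ tildeU 1 (hatPhi a q)) := fun w hw => by
    have h := D.between_iff hw hz0
    simp only [tildeU, mem_ofPred_eq, hα, hpz]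
    exact h
  ext x
  constructor
  · rintro ⟨hx, hpre⟩
    have hle : alpha M q ≼ spell a 1 := ((hJ.mem_Ioc_iff hq.1.1).1 hq.2).2
    rw [ofFn_eq_plusWord_iff] at hpre
    -- The prefix `a⁺` supplies the lower bound required for decoding.
    have h0 : spell a 0 ≺ x := by
      have hm := D.pos
      refine lex_lt_iff.2 ⟨a.length - 1, fun j hj => ?_, ?_⟩
      · rw [spell, expand_apply_lt 0 0 (by omega), hpre j (by omega), D.plus_eq j (by omega)]
        simp [blk]
      · rw [spell, expand_apply_lt 0 0 (by omega), hpre _ (by omega)]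
        simpa [blk] using D.last_lt
    obtain ⟨w, rfl⟩ := hJ.exists_eq_spell h0.le
      (fun n => (reflect_le_reflect.2 hle).trans (hx n).1.le) fun n => (hx n).2.le.trans hle
    have hw : w 0 = 1 := by
      refine (bit_cases _).resolve_left fun hw => ?_
      have hm := D.pos
      have h := hpre (a.length - 1) (by omega)
      rw [spell, expand_apply_lt 0 w (by omega), hw] at h
      simp only [blk, if_true] at h
      exact D.last_lt.ne h
    exact ⟨w, ⟨(hiff w hw).1 hx, hw⟩, rfl⟩
  · rintro ⟨w, ⟨hw, hw0⟩, rfl⟩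
    exact ⟨(hiff w hw0).2 hw, ofFn_eq_plusWord_iff.2 (BlockData.expand_zero_prefix hw0)⟩

end IsBasicInterval

end Renormalization

end UnivoqueBases

theorem mainTheorem9 (M : ℕ) (hM : 1 ≤ M) (a : Word M) (qL qR : ℝ)
    (hJ : IsBasicInterval a qL qR) :
    -- the induced map is well defined on `𝒱 ∩ (qL, qR]`
    (∀ q ∈ bifV M ∩ Set.Ioc qL qR, alpha M q ∈ XJ a ∧
      alpha 1 (hatPhi a q) = Phi a (alpha M q)) ∧
    -- (i)
    StrictMonoOn (hatPhi a) (bifV M ∩ Set.Ioc qL qR) ∧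
    (∃ e : ↥(bifV M ∩ Set.Ioc qL qR) ≃ₜ ↥(bifV 1), ∀ q, (e q : ℝ) = hatPhi a (q : ℝ)) ∧
    -- (ii)
    (univoqueBases M ∩ Set.Icc qL qR ⊆ bifV M ∩ Set.Ioc qL qR ∧
      hatPhi a '' (univoqueBases M ∩ Set.Ioc qL qR) = univoqueBases 1 ∧
      hatPhi a '' (univoqueBases M ∩ Set.Icc qL qR) = univoqueBases 1) ∧
    -- (iii)
    (∀ q ∈ bifV M ∩ Set.Ioc qL qR,
      tildeUJ a q ⊆ XJ a ∧
      Set.BijOn (Phi a) (tildeUJ a q) {x | x ∈ tildeU 1 (hatPhi a q) ∧ x 0 = 1} ∧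
      entropy (tildeUJ a q) = entropy (tildeU 1 (hatPhi a q)) / (a.length : ℝ)) := by
  have ha := hJ.admissible
  refine ⟨fun q hq => ?_, hJ.hatPhi_strictMonoOn hM, hJ.exists_homeomorph hM,
    ⟨hJ.univoqueBases_inter_Icc_subset hM, ?_, hJ.image_univoqueBases hM⟩, fun q hq => ?_⟩
  · obtain ⟨z, -, hz0, hα, -, hpz⟩ := hJ.hatPhi_spec hM hq
    rw [hα, Phi_spell ha hz0]
    exact ⟨spell_mem_XJ ha.length_pos hz0, hpz⟩
  · rw [← hJ.image_univoqueBases hM]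
    congr 1
    exact Subset.antisymm (inter_subset_inter_right _ Ioc_subset_Icc_self)
      fun q hq => ⟨hq.1, (hJ.univoqueBases_inter_Icc_subset hM hq).2⟩
  · rw [hJ.tildeUJ_eq hM hq]
    refine ⟨?_, ⟨?_, ?_, ?_⟩, ?_⟩
    · rintro _ ⟨z, ⟨-, hz⟩, rfl⟩
      exact spell_mem_XJ ha.length_pos hz
    · rintro _ ⟨z, hz, rfl⟩
      rw [Phi_spell ha hz.2]
      exact hz
    · rintro _ ⟨z, hz, rfl⟩ _ ⟨w, hw, rfl⟩ h
      rw [Phi_spell ha hz.2, Phi_spell ha hw.2] at h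
      rw [h]
    · intro z hz
      exact ⟨_, ⟨z, hz, rfl⟩, Phi_spell ha hz.2⟩
    · exact ha.blockData.entropy_expand (fun x hx k => shift_mem_tildeU hx k)
        fun x hx => reflect_mem_tildeU hx
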